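/- All graphs are finite and simple. A graph $G$ is $(k,d)$-colourable if each vertex can be assigned one of $k$ colours so that every vertex has at most $d$ neighbours of its own colour. The defective chromatic number of a graph class $\mathcal C$ is the minimum integer $k$ for which there is an integer $d$ such that every graph in $\mathcal C$ is $(k,d)$-colourable. A graph is $H$-minor-free if it does not contain $H$ as a minor. The tree-depth of a connected graph $H$ is the minimum height of a rooted tree $T$ such that $H$ is a subgraph of the closure of $T$; here the height is the maximum number of vertices on a root-to-leaf path, and the closure is obtained by adding an edge between every ancestor and descendant. The tree-depth of a disconnected graph is the maximum tree-depth of its connected components. (1) For every graph $H$ of tree-depth $3$ with at most one component of tree-depth $3$, the defective chromatic number of the class of $H$-minor-free graphs equals $2$. (2) There is an absolute constant $C$ such that, for all integers $\ell\ge 2$ and $k\ge 1$, if $H$ is the graph obtained from $\ell$ disjoint copies of $K_{1,k}$ by adding one dominant vertex (a new vertex adjacent to all others), then every $H$-minor-free graph is $(2,\,C\,\ell^{10}k^{3})$-colourable. -/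

import Mathlib

universe u v

namespace DefectiveColouring

/-- `G` is `(k, d)`-colourable: each vertex gets one of `k` colours so that every vertex has at
most `d` neighbours of its own colour. -/
def DefectColourable {V : Type u} (G : SimpleGraph V) (k d : ℕ) : Prop :=
  ∃ c : V → Fin k, ∀ x : V, {y : V | G.Adj x y ∧ c y = c x}.encard ≤ (d : ℕ∞)

/-- `k` is the defective chromatic number of the graph class `𝒞`: the least `k` for which there is
`d` such that every graph in `𝒞` is `(k, d)`-colourable. -/
def IsDefectiveChromaticNumber (𝒞 : (V : Type u) → SimpleGraph V → Prop) (k : ℕ) : Prop :=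
  IsLeast {k : ℕ | ∃ d : ℕ, ∀ (V : Type u) (G : SimpleGraph V), 𝒞 V G → DefectColourable G k d} k

/-- `H` is a minor of `G`. The branch set `B w` is the set of vertices that are contracted to the
vertex `w` of `H`; vertices in no branch set, and superfluous edges, are deleted. -/
def IsMinor {W : Type v} {V : Type u} (H : SimpleGraph W) (G : SimpleGraph V) : Prop :=
  ∃ B : W → Set V,
    (∀ w, (G.induce (B w)).Connected) ∧
    (∀ w₁ w₂, w₁ ≠ w₂ → Disjoint (B w₁) (B w₂)) ∧
    (∀ w₁ w₂, H.Adj w₁ w₂ → ∃ x ∈ B w₁, ∃ y ∈ B w₂, G.Adj x y)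

/-- The class of (finite) `H`-minor-free graphs. -/
def MinorFree {W : Type v} (H : SimpleGraph W) (V : Type u) (G : SimpleGraph V) : Prop :=
  Finite V ∧ ¬ IsMinor H G

/-- In the tree `T` rooted at `r`, the vertex `x` is an ancestor of `y` (or `y` itself): it lies on
the path from `r` to `y`. -/
def IsAncestor {V : Type u} (T : SimpleGraph V) (r x y : V) : Prop :=
  ∃ p : T.Path r y, x ∈ (p : T.Walk r y).support

/-- The closure of the tree `T` rooted at `r`: an edge between any two distinct vertices one of
which is an ancestor of the other. -/
def treeClosure {V : Type u} (T : SimpleGraph V) (r : V) : SimpleGraph V where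
  Adj x y := x ≠ y ∧ (IsAncestor T r x y ∨ IsAncestor T r y x)
  symm := ⟨fun _ _ h => ⟨h.1.symm, h.2.symm⟩⟩
  loopless := ⟨fun _ h => h.1 rfl⟩

/-- The height of the tree `T` rooted at `r`: the maximum number of vertices on a path that starts
at the root (a longest such path ends at a leaf). -/
noncomputable def treeHeight {V : Type u} (T : SimpleGraph V) (r : V) : ℕ∞ :=
  ⨆ (y : V) (p : T.Path r y), ((p : T.Walk r y).support.length : ℕ∞)

/-- The tree-depth of a connected finite graph `H`: the minimum height of a finite rooted tree such
that `H` is (isomorphic to) a subgraph of its closure. -/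
noncomputable def connectedTreeDepth {W : Type v} (H : SimpleGraph W) : ℕ∞ :=
  sInf {h : ℕ∞ | ∃ (n : ℕ) (T : SimpleGraph (Fin n)) (r : Fin n),
    T.IsTree ∧ treeHeight T r = h ∧ H.IsContained (treeClosure T r)}

/-- The tree-depth of a finite graph: the maximum of the tree-depths of its components. -/
noncomputable def treeDepth {W : Type v} (H : SimpleGraph W) : ℕ∞ :=
  ⨆ c : H.ConnectedComponent, connectedTreeDepth c.toSimpleGraph

/-- `ℓ` pairwise disjoint copies of `G`. -/
def disjointCopies {V : Type u} (ℓ : ℕ) (G : SimpleGraph V) : SimpleGraph (Fin ℓ × V) where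
  Adj x y := x.1 = y.1 ∧ G.Adj x.2 y.2
  symm := ⟨fun _ _ h => ⟨h.1.symm, h.2.symm⟩⟩
  loopless := ⟨fun _ h => h.2.ne rfl⟩

/-- `G` with one new vertex `none`, adjacent to all vertices of `G`. -/
def addDominant {V : Type u} (G : SimpleGraph V) : SimpleGraph (Option V) where
  Adj x y := x ≠ y ∧ ∀ a b : V, x = some a → y = some b → G.Adj a b
  symm := ⟨fun _ _ h => ⟨h.1.symm, fun a b ha hb => (h.2 b a hb ha).symm⟩⟩
  loopless := ⟨fun _ h => h.1 rfl⟩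

/-- The graph obtained from `ℓ` disjoint copies of the star `K_{1,k}` by adding one dominant
vertex. -/
def dominatedStars (ℓ k : ℕ) : SimpleGraph (Option (Fin ℓ × (Fin 1 ⊕ Fin k))) :=
  addDominant (disjointCopies ℓ (completeBipartiteGraph (Fin 1) (Fin k)))

end DefectiveColouring

/-! Everything reduces to part (2). A component of tree-depth at most 2 is a star plus isolated
vertices, and one of tree-depth 3 becomes such a disjoint union of stars after deleting one vertex.
Since only one component needs that vertex, `H` embeds in some dominated family of stars, so (2)
bounds the defective chromatic number by 2. One colour is not enough: minors of stars have
tree-depth at most 2, so all stars are `H`-minor-free, and their degrees are unbounded.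

For (2), a stronger rooted statement is proved by induction (`exists_rooted_colouring`): the colour
of a root `r` is prescribed, and `r` and its neighbours of that colour have at most `2 * ℓ`
neighbours of their own colour. From `r`, greedily grow a set `W` of hubs, where each new hub has
many neighbours outside the current set that see an earlier hub. At a maximal `W` every outside
vertex has few neighbours in `N(W)`. Colour `W` with `γ` and `N(W)` with the other colour, contract
`W ∪ N(W)`, and colour the quotient inductively with the contracted vertex, in the other colour, as
root. The rooted condition prevents the two sources of defect from adding up badly.

The crux is that hubs induce bounded degree (`card_neighbours_in_hubs_le`). Let a hub have as parent
an earlier hub with which it shares more than `ℓ * k` links. A root of this forest must have links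
spread over many earlier hubs. If these lie in many trees, contracting the trees gives a dense
minor, which contains the dominated stars (`isMinor_dominatedStars_of_dense`). If some hub reaches
many hubs in few trees, `ℓ` of these can be cut out as star centres, with links to their parents as
leaves, while the rest stays connected and serves as the dominant vertex (`card_marks_lt`). Hence
there is one tree, and each hub has at most `2 * ℓ` hub neighbours. -/

namespace DefectiveColouring

/-! ### Minors and ways of exhibiting dominated stars -/

section Minors

variable {V : Type*} {X : Type*} {W : Type*}

/-- `b` can be reached from `a` by a walk of `G` all of whose vertices after `a` are in `S`. -/
def Joined (G : SimpleGraph V) (S : Set V) (a b : V) : Prop :=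
  Relation.ReflTransGen (fun x y => G.Adj x y ∧ y ∈ S) a b

lemma Joined.step {G : SimpleGraph V} {S : Set V} {a b c : V} (h : Joined G S a b)
    (hbc : G.Adj b c) (hc : c ∈ S) : Joined G S a c :=
  Relation.ReflTransGen.tail h ⟨hbc, hc⟩

lemma Joined.mono {G : SimpleGraph V} {S T : Set V} {a b : V} (h : Joined G S a b) (hST : S ⊆ T) :
    Joined G T a b := by
  induction h with
  | refl => exact Relation.ReflTransGen.refl
  | tail _ hbc ih => exact ih.step hbc.1 (hST hbc.2)

lemma connected_of_joined {G : SimpleGraph V} {S : Set V} {v : V} (hv : v ∈ S)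
    (h : ∀ x ∈ S, Joined G S v x) : (G.induce S).Connected := by
  have key : ∀ x, Joined G S v x → ∃ hx : x ∈ S, (G.induce S).Reachable ⟨v, hv⟩ ⟨x, hx⟩ := by
    intro x hx
    induction hx with
    | refl => exact ⟨hv, SimpleGraph.Reachable.refl _⟩
    | tail _ hbc ih =>
      obtain ⟨hb, hr⟩ := ih
      refine ⟨hbc.2, hr.trans (SimpleGraph.Adj.reachable ?_)⟩
      exact hbc.1
  rw [SimpleGraph.connected_iff_exists_forall_reachable]
  exact ⟨⟨v, hv⟩, fun ⟨x, hx⟩ => (key x (h x hx)).2⟩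

lemma joined_of_connected {G : SimpleGraph V} {S : Set V} (h : (G.induce S).Connected) {a b : V}
    (ha : a ∈ S) (hb : b ∈ S) : Joined G S a b := by
  have key : ∀ x : S, (G.induce S).Reachable ⟨a, ha⟩ x → Joined G S a x := by
    intro x hx
    rw [SimpleGraph.reachable_iff_reflTransGen] at hx
    induction hx with
    | refl => exact Relation.ReflTransGen.refl
    | tail _ hbc ih => exact ih.step hbc (Subtype.prop _)
  exact key ⟨b, hb⟩ (h.preconnected _ _)

lemma connected_induce_singleton (G : SimpleGraph V) (x : V) : (G.induce {x}).Connected :=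
  connected_of_joined (v := x) rfl (by rintro _ rfl; exact Relation.ReflTransGen.refl)

lemma IsMinor.trans {H : SimpleGraph W} {Q : SimpleGraph X} {G : SimpleGraph V}
    (h₁ : IsMinor H Q) (h₂ : IsMinor Q G) : IsMinor H G := by
  obtain ⟨B₁, conn₁, disj₁, adj₁⟩ := h₁
  obtain ⟨B₂, conn₂, disj₂, adj₂⟩ := h₂
  refine ⟨fun w => ⋃ x ∈ B₁ w, B₂ x, fun w => ?_, fun w₁ w₂ hw => ?_, fun w₁ w₂ hw => ?_⟩
  · obtain ⟨⟨x₀, hx₀⟩⟩ := (conn₁ w).nonempty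
    obtain ⟨⟨v₀, hv₀⟩⟩ := (conn₂ x₀).nonempty
    have sub : ∀ {x}, x ∈ B₁ w → B₂ x ⊆ ⋃ x ∈ B₁ w, B₂ x := fun {x} hx =>
      Set.subset_biUnion_of_mem (u := fun x => B₂ x) hx
    have key : ∀ x, Joined Q (B₁ w) x₀ x → x ∈ B₁ w ∧
        ∀ y ∈ B₂ x, Joined G (⋃ x ∈ B₁ w, B₂ x) v₀ y := by
      intro x hx
      induction hx with
      | refl => exact ⟨hx₀, fun y hy => (joined_of_connected (conn₂ x₀) hv₀ hy).mono (sub hx₀)⟩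
      | tail _ hbc ih =>
        refine ⟨hbc.2, fun y hy => ?_⟩
        obtain ⟨p, hp, q, hq, hpq⟩ := adj₂ _ _ hbc.1
        exact ((ih.2 p hp).step hpq (sub hbc.2 hq)).trans
          ((joined_of_connected (conn₂ _) hq hy).mono (sub hbc.2))
    refine connected_of_joined (sub hx₀ hv₀) fun y hy => ?_
    obtain ⟨x, hx, hyx⟩ := Set.mem_iUnion₂.1 hy
    exact (key x (joined_of_connected (conn₁ w) hx₀ hx)).2 y hyx
  · simp only [Set.disjoint_iUnion_left, Set.disjoint_iUnion_right]
    intro x hx y hy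
    exact disj₂ _ _ (by rintro rfl; exact Set.disjoint_left.1 (disj₁ _ _ hw) hy hx)
  · obtain ⟨x, hx, y, hy, hxy⟩ := adj₁ _ _ hw
    obtain ⟨p, hp, q, hq, hpq⟩ := adj₂ _ _ hxy
    exact ⟨p, Set.mem_biUnion hx hp, q, Set.mem_biUnion hy hq, hpq⟩

lemma isMinor_of_hom {Q : SimpleGraph X} {G : SimpleGraph V} (f : X → V)
    (hf : Function.Injective f) (hadj : ∀ x y, Q.Adj x y → G.Adj (f x) (f y)) : IsMinor Q G := by
  refine ⟨fun x => {f x}, fun x => connected_induce_singleton G _, fun x y hxy => ?_,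
    fun x y hxy => ⟨f x, rfl, f y, rfl, hadj x y hxy⟩⟩
  simpa using fun h => hxy (hf h)

lemma isMinor_induce (G : SimpleGraph V) (S : Set V) : IsMinor (G.induce S) G :=
  isMinor_of_hom (fun x => x.1) Subtype.val_injective fun _ _ h => h

lemma isMinor_dominatedStars_of_connected {G : SimpleGraph V} {ℓ k : ℕ} {D : Set V}
    (hD : (G.induce D).Connected) (ctr : Fin ℓ → V) (lf : Fin ℓ × Fin k → V)
    (hctr : Function.Injective ctr) (hlf : Function.Injective lf)
    (hne : ∀ i x, ctr i ≠ lf x) (hctrD : ∀ i, ctr i ∉ D) (hlfD : ∀ x, lf x ∉ D)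
    (hadj : ∀ i j, G.Adj (ctr i) (lf (i, j))) (hctrA : ∀ i, ∃ y ∈ D, G.Adj (ctr i) y)
    (hlfA : ∀ x, ∃ y ∈ D, G.Adj (lf x) y) : IsMinor (dominatedStars ℓ k) G := by
  refine ⟨fun w => match w with
    | none => D
    | some (i, Sum.inl _) => {ctr i}
    | some (i, Sum.inr j) => {lf (i, j)}, ?_, ?_, ?_⟩
  · rintro (_ | ⟨i, _ | j⟩)
    · exact hD
    · exact connected_induce_singleton _ _
    · exact connected_induce_singleton _ _
  · rintro (_ | ⟨i, a | j⟩) (_ | ⟨i', a' | j'⟩) hw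
    · exact absurd rfl hw
    · simpa using hctrD i'
    · simpa using hlfD (i', j')
    · simpa using hctrD i
    · have : i ≠ i' := by
        rintro rfl
        exact hw (by rw [Subsingleton.elim a a'])
      simpa using fun h => this (hctr h)
    · simpa using hne i (i', j')
    · simpa using hlfD (i, j)
    · simpa using (hne i' (i, j)).symm
    · have : (i, j) ≠ (i', j') := by
        rintro h
        simp only [Prod.mk.injEq] at h
        exact hw (by rw [h.1, h.2])
      simpa using fun h => this (hlf h)
  · rintro (_ | ⟨i, a | j⟩) (_ | ⟨i', a' | j'⟩) ⟨hw, h⟩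
    · exact absurd rfl hw
    · obtain ⟨y, hy, h⟩ := hctrA i'
      exact ⟨y, hy, _, rfl, h.symm⟩
    · obtain ⟨y, hy, h⟩ := hlfA (i', j')
      exact ⟨y, hy, _, rfl, h.symm⟩
    · obtain ⟨y, hy, h⟩ := hctrA i
      exact ⟨_, rfl, y, hy, h⟩
    · have := h _ _ rfl rfl
      simp [disjointCopies] at this
    · have := h _ _ rfl rfl
      simp only [disjointCopies] at this
      obtain rfl : i = i' := this.1
      exact ⟨_, rfl, _, rfl, hadj i j'⟩
    · obtain ⟨y, hy, h⟩ := hlfA (i, j)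
      exact ⟨_, rfl, y, hy, h⟩
    · have := h _ _ rfl rfl
      simp only [disjointCopies] at this
      obtain rfl : i = i' := this.1
      exact ⟨_, rfl, _, rfl, (hadj i j).symm⟩
    · have := h _ _ rfl rfl
      simp [disjointCopies] at this

/-- The branch set of the dominant vertex is everything reachable from `v` while avoiding the chosen
centres and leaves. It is thus enough to reach a neighbour of each of them. -/
lemma isMinor_dominatedStars_of_joined {G : SimpleGraph V} {ℓ k : ℕ} (v : V)
    (ctr : Fin ℓ → V) (lf : Fin ℓ × Fin k → V)
    (hctr : Function.Injective ctr) (hlf : Function.Injective lf)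
    (hne : ∀ i x, ctr i ≠ lf x) (hvc : ∀ i, ctr i ≠ v) (hvl : ∀ x, lf x ≠ v)
    (hadj : ∀ i j, G.Adj (ctr i) (lf (i, j)))
    (hctrA : ∀ i, ∃ y, G.Adj (ctr i) y ∧ Joined G {z | (∀ i, ctr i ≠ z) ∧ ∀ x, lf x ≠ z} v y)
    (hlfA : ∀ x, ∃ y, G.Adj (lf x) y ∧ Joined G {z | (∀ i, ctr i ≠ z) ∧ ∀ x, lf x ≠ z} v y) :
    IsMinor (dominatedStars ℓ k) G := by
  set S : Set V := {z | (∀ i, ctr i ≠ z) ∧ ∀ x, lf x ≠ z} with hS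
  have hvS : v ∈ S := ⟨hvc, hvl⟩
  have hsub : ∀ {x}, Joined G S v x → x ∈ S := by
    intro x hx
    cases hx with
    | refl => exact hvS
    | tail _ h => exact h.2
  refine isMinor_dominatedStars_of_connected (D := {x | Joined G S v x}) ?_ ctr lf hctr hlf hne
    (fun i hi => (hsub hi).1 i rfl) (fun x hx => (hsub hx).2 x rfl) hadj
    (fun i => ?_) (fun x => ?_)
  · refine connected_of_joined (v := v) Relation.ReflTransGen.refl fun x hx => ?_
    change Joined G S v x at hx
    induction hx with
    | refl => exact Relation.ReflTransGen.refl
    | tail h₁ h₂ ih => exact ih.step h₂.1 (Joined.step h₁ h₂.1 h₂.2)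
  · obtain ⟨y, h₁, h₂⟩ := hctrA i
    exact ⟨y, h₂, h₁⟩
  · obtain ⟨y, h₁, h₂⟩ := hlfA x
    exact ⟨y, h₂, h₁⟩

/-- Hall's condition is trivial here, since each single list is already as long as the number of
indices. -/
lemma exists_injective_prod_of_le_card {ℓ k : ℕ} (A : Fin ℓ → Finset V)
    (hA : ∀ i, ℓ * k ≤ (A i).card) :
    ∃ f : Fin ℓ × Fin k → V, Function.Injective f ∧ ∀ i j, f (i, j) ∈ A i := by
  classical
  obtain ⟨f, hf, hfA⟩ := (Finset.all_card_le_biUnion_card_iff_exists_injective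
    (fun x : Fin ℓ × Fin k => A x.1)).1 (by
      intro s
      rcases s.eq_empty_or_nonempty with rfl | ⟨x, hx⟩
      · simp
      · calc s.card ≤ Fintype.card (Fin ℓ × Fin k) := Finset.card_le_univ s
          _ = ℓ * k := by simp
          _ ≤ (A x.1).card := hA _
          _ ≤ _ := Finset.card_le_card (Finset.subset_biUnion_of_mem (fun x : Fin ℓ × Fin k => A x.1) hx))
  exact ⟨f, hf, fun i j => hfA (i, j)⟩

end Minors

end DefectiveColouring

namespace DefectiveColouring

/-! ### Dense graphs contain dominated stars -/

section Density

variable {V : Type*}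

open Classical in
/-- The number of ordered pairs of adjacent vertices. -/
noncomputable def adjPairs [Fintype V] (G : SimpleGraph V) : Finset (V × V) :=
  Finset.univ.filter fun p => G.Adj p.1 p.2

open Classical in
-- With `v` as dominant vertex, any `ℓ` of its neighbours serve as centres. Discarding these `ℓ`
-- from the `ℓ * (k + 1)` common neighbours leaves `ℓ * k` candidate leaves per centre, enough to
-- choose all leaves distinct.
lemma isMinor_dominatedStars_of_common_neighbours [Fintype V] {G : SimpleGraph V} {ℓ k : ℕ}
    {v x : V} (hvx : G.Adj v x)
    (h : ∀ y, G.Adj v y →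
      ℓ * (k + 1) ≤ (Finset.univ.filter fun z => G.Adj v z ∧ G.Adj y z).card) :
    IsMinor (dominatedStars ℓ k) G := by
  set N : Finset V := Finset.univ.filter fun z => G.Adj v z with hN
  have hcard : Fintype.card (Fin ℓ) ≤ N.card := by
    rw [Fintype.card_fin]
    calc ℓ ≤ ℓ * (k + 1) := Nat.le_mul_of_pos_right _ (Nat.succ_pos _)
      _ ≤ _ := h x hvx
      _ ≤ N.card := Finset.card_le_card fun z hz => by simp_all
  obtain ⟨c⟩ : Nonempty (Fin ℓ ↪ N) :=
    Function.Embedding.nonempty_of_card_le (by rwa [Fintype.card_coe])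
  have hc : ∀ i, G.Adj v (c i) := fun i =>
    (Finset.mem_filter.1 (c i).2).2
  obtain ⟨lf, hlf, hlfA⟩ := exists_injective_prod_of_le_card (ℓ := ℓ) (k := k)
    (fun i => (Finset.univ.filter fun z => G.Adj v z ∧ G.Adj (c i) z) \
      Finset.univ.image fun i => (c i : V)) (by
      intro i
      have h₁ := Finset.le_card_sdiff (Finset.univ.image fun i => (c i : V))
        (Finset.univ.filter fun z => G.Adj v z ∧ G.Adj (c i) z)
      have h₂ := h _ (hc i)
      have h₃ : (Finset.univ.image fun i => (c i : V)).card ≤ ℓ := by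
        simpa using Finset.card_image_le (s := Finset.univ) (f := fun i => (c i : V))
      rw [Nat.mul_add, Nat.mul_one] at h₂
      omega)
  simp only [Finset.mem_sdiff, Finset.mem_filter, Finset.mem_univ, true_and, Finset.mem_image,
    not_exists] at hlfA
  refine isMinor_dominatedStars_of_connected (connected_induce_singleton G v)
    (fun i => c i) lf (Subtype.val_injective.comp c.injective) hlf ?_ ?_ ?_
    (fun i j => (hlfA i j).1.2) (fun i => ⟨v, rfl, (hc i).symm⟩)
    (fun x => ⟨v, rfl, (hlfA x.1 x.2).1.1.symm⟩)
  · exact fun i x => (hlfA x.1 x.2).2 i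
  · exact fun i => (hc i).ne'
  · exact fun x => (hlfA x.1 x.2).1.1.ne'

/-- The graph obtained by contracting `y` into `x`. -/
def contractInto (G : SimpleGraph V) (x y : V) : SimpleGraph {z // z ≠ y} where
  Adj a b := a ≠ b ∧ (G.Adj a b ∨ (a.1 = x ∧ G.Adj y b) ∨ (b.1 = x ∧ G.Adj y a))
  symm := ⟨fun _ _ h => ⟨h.1.symm, by
    rcases h.2 with h | h | h
    · exact Or.inl h.symm
    · exact Or.inr (Or.inr h)
    · exact Or.inr (Or.inl h)⟩⟩
  loopless := ⟨fun _ h => h.1 rfl⟩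

lemma isMinor_contractInto {G : SimpleGraph V} {x y : V} (hxy : G.Adj x y) :
    IsMinor (contractInto G x y) G := by
  refine ⟨fun a => {z | z = a.1 ∨ (a.1 = x ∧ z = y)}, fun a => ?_, fun a b hab => ?_,
    fun a b hab => ?_⟩
  · refine connected_of_joined (v := a.1) (Or.inl rfl) fun z hz => ?_
    rcases hz with rfl | ⟨ha, rfl⟩
    · exact Relation.ReflTransGen.refl
    · exact Relation.ReflTransGen.single ⟨ha ▸ hxy, Or.inr ⟨ha, rfl⟩⟩
  · rw [Set.disjoint_left]
    rintro z (rfl | ⟨ha, rfl⟩) (hz | ⟨hb, hz⟩)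
    · exact hab (Subtype.ext hz)
    · exact a.2 hz
    · exact b.2 hz.symm
    · exact hab (Subtype.ext (ha.trans hb.symm))
  · rcases hab.2 with h | ⟨ha, h⟩ | ⟨hb, h⟩
    · exact ⟨_, Or.inl rfl, _, Or.inl rfl, h⟩
    · exact ⟨y, Or.inr ⟨ha, rfl⟩, _, Or.inl rfl, h⟩
    · exact ⟨_, Or.inl rfl, y, Or.inr ⟨hb, rfl⟩, h.symm⟩

open Classical in
lemma card_adjPairs_le_contractInto [Fintype V] {G : SimpleGraph V} {x y : V} (hxy : G.Adj x y) :
    (adjPairs G).card ≤ (adjPairs (contractInto G x y)).card +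
      (2 + 2 * (Finset.univ.filter fun z => G.Adj x z ∧ G.Adj y z).card) := by
  set N := Finset.univ.filter fun z => G.Adj x z ∧ G.Adj y z with hN
  -- The ordered pairs lost in the contraction: the edge `xy` itself, and the edges from `y` to
  -- common neighbours `z`, which merge with `xz`.
  set E : Finset (V × V) := {(x, y), (y, x)} ∪ (N.image (fun z => (y, z)) ∪
    N.image (fun z => (z, y))) with hE
  have hEcard : E.card ≤ 2 + 2 * N.card := by
    have h₁ := Finset.card_union_le ({(x, y), (y, x)} : Finset (V × V))
      (N.image (fun z => (y, z)) ∪ N.image (fun z => (z, y)))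
    have h₂ := Finset.card_union_le (N.image (fun z => (y, z))) (N.image (fun z => (z, y)))
    have h₃ := Finset.card_image_le (s := N) (f := fun z => (y, z))
    have h₄ := Finset.card_image_le (s := N) (f := fun z => (z, y))
    have h₅ := Finset.card_le_two (a := (x, y)) (b := (y, x))
    rw [hE]
    omega
  have hle := Finset.le_card_sdiff E (adjPairs G)
  suffices h : (adjPairs G \ E).card ≤ (adjPairs (contractInto G x y)).card by omega
  have hxy' : x ≠ y := hxy.ne
  let σ : V → {z // z ≠ y} := fun z => if hz : z = y then ⟨x, hxy'⟩ else ⟨z, hz⟩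
  have hσy : (σ y).1 = x := by simp [σ]
  have hσ : ∀ z, z ≠ y → (σ z).1 = z := fun z hz => by simp [σ, hz]
  have hmem : ∀ p ∈ adjPairs G \ E, G.Adj p.1 p.2 ∧ (p.1 = y → p.2 ≠ x ∧ ¬ G.Adj x p.2) ∧
      (p.2 = y → p.1 ≠ x ∧ ¬ G.Adj x p.1) := by
    rintro ⟨a, b⟩ hp
    simp only [adjPairs, hE, hN, Finset.mem_sdiff, Finset.mem_filter, Finset.mem_univ, true_and,
      Finset.mem_union, Finset.mem_insert, Finset.mem_singleton, Finset.mem_image, not_or,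
      Prod.mk.injEq, not_exists, not_and] at hp
    obtain ⟨hab, ⟨h₁, h₂⟩, h₃, h₄⟩ := hp
    refine ⟨hab, ?_, ?_⟩
    · rintro rfl
      exact ⟨h₂ rfl, fun h => h₃ b ⟨h, hab⟩ rfl rfl⟩
    · rintro rfl
      exact ⟨fun h => h₁ h rfl, fun h => h₄ a ⟨h, hab.symm⟩ rfl rfl⟩
  refine Finset.card_le_card_of_injOn (fun p => (σ p.1, σ p.2)) ?_ ?_
  · rintro ⟨a, b⟩ hp
    obtain ⟨hab, h₁, h₂⟩ := hmem _ hp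
    simp only [adjPairs, Finset.coe_filter, Finset.mem_univ, true_and, Set.mem_ofPred_eq]
    simp only at hab h₁ h₂
    have hne : a ≠ b := hab.ne
    by_cases ha : a = y
    · subst ha
      have hb := hσ b hne.symm
      refine ⟨fun h => (h₁ rfl).1 ?_, Or.inr (Or.inl ⟨hσy, by rwa [hb]⟩)⟩
      rw [← hb, ← h, hσy]
    · by_cases hb : b = y
      · subst hb
        have ha := hσ a hne
        refine ⟨fun h => (h₂ rfl).1 ?_, Or.inr (Or.inr ⟨hσy, by rw [ha]; exact hab.symm⟩)⟩
        rw [← ha, h, hσy]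
      · have ha := hσ a ha
        have hb := hσ b hb
        refine ⟨fun h => hne ?_, Or.inl (by rwa [ha, hb])⟩
        rw [← ha, ← hb, h]
  · rintro ⟨a, b⟩ hp ⟨a', b'⟩ hp' heq
    obtain ⟨hab, h₁, h₂⟩ := hmem _ hp
    obtain ⟨hab', h₁', h₂'⟩ := hmem _ hp'
    simp only [Prod.mk.injEq] at heq hab h₁ h₂ hab' h₁' h₂' ⊢
    have e₁ : (σ a).1 = (σ a').1 := by rw [heq.1]
    have e₂ : (σ b).1 = (σ b').1 := by rw [heq.2]
    have := hσ a
    have := hσ b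
    have := hσ a'
    have := hσ b'
    have hs : ∀ u v, G.Adj u v → G.Adj v u := fun u v h => h.symm
    have hi := G.irrefl (v := y)
    grind

open Classical in
-- Contracting an edge in fewer than `ℓ * (k + 1)` triangles loses at most `2 * (ℓ * (k + 1))`
-- ordered pairs and one vertex, so density survives. When no such edge is left, every neighbourhood
-- is itself dense enough to contain the stars.
theorem isMinor_dominatedStars_of_dense {ℓ k : ℕ} (hℓ : 1 ≤ ℓ) (n : ℕ) :
    ∀ {V : Type u} [Fintype V] [Nonempty V] (G : SimpleGraph V), Fintype.card V = n →
      2 * (ℓ * (k + 1)) * n ≤ (adjPairs G).card → IsMinor (dominatedStars ℓ k) G := by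
  induction n with
  | zero =>
    intro V _ _ G hn _
    exact absurd hn Fintype.card_ne_zero
  | succ n ih =>
    intro V _ _ G hn hdense
    by_cases h : ∃ x y, G.Adj x y ∧
        (Finset.univ.filter fun z => G.Adj x z ∧ G.Adj y z).card < ℓ * (k + 1)
    · obtain ⟨x, y, hxy, hlt⟩ := h
      have : Nonempty {z // z ≠ y} := ⟨⟨x, hxy.ne⟩⟩
      refine (ih (contractInto G x y) (by simp [hn]) ?_).trans (isMinor_contractInto hxy)
      have := card_adjPairs_le_contractInto hxy
      rw [Nat.mul_add] at hdense
      rw [Nat.mul_assoc 2, Nat.mul_assoc 2] at hdense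
      rw [Nat.mul_assoc 2]
      omega
    · push Not at h
      have hpos : 0 < (adjPairs G).card := lt_of_lt_of_le (by positivity) hdense
      obtain ⟨⟨v, x⟩, hvx⟩ := Finset.card_pos.1 hpos
      simp only [adjPairs, Finset.mem_filter, Finset.mem_univ, true_and] at hvx
      exact isMinor_dominatedStars_of_common_neighbours hvx fun y hy => h v y hy

/-- A graph in which every vertex but the least has many smaller neighbours is dense. -/
lemma isMinor_dominatedStars_of_lower_neighbours {ℓ k : ℕ} (hℓ : 1 ≤ ℓ) {R : Finset ℕ}
    {o : ℕ} (ho : o ∈ R) (hR : 1 < R.card) (Q : SimpleGraph R)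
    (T : ℕ → Finset ℕ) (hT : ∀ x ∈ R, x ≠ o → 2 * (ℓ * (k + 1)) ≤ (T x).card)
    (hTR : ∀ x ∈ R, x ≠ o → ∀ t ∈ T x, t < x ∧ ∃ ht : t ∈ R, ∀ hx : x ∈ R, Q.Adj ⟨x, hx⟩ ⟨t, ht⟩) :
    IsMinor (dominatedStars ℓ k) Q := by
  classical
  set m := ℓ * (k + 1)
  have : Nonempty R := ⟨⟨o, ho⟩⟩
  refine isMinor_dominatedStars_of_dense hℓ (Fintype.card R) Q rfl ?_
  rw [Fintype.card_coe]
  set P : Finset (ℕ × ℕ) := (adjPairs Q).image fun p => (p.1.1, p.2.1)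
  have hP : P.card ≤ (adjPairs Q).card := Finset.card_image_le
  set L : Finset (ℕ × ℕ) := ((R.erase o).sigma T).image fun p => (p.1, p.2) with hL
  have hLcard : (R.card - 1) * (2 * m) ≤ L.card := by
    rw [hL, Finset.card_image_of_injective, Finset.card_sigma, ← Finset.card_erase_of_mem ho,
      ← smul_eq_mul]
    · refine Finset.card_nsmul_le_sum _ _ _ fun x hx => ?_
      exact hT x (Finset.mem_of_mem_erase hx) (Finset.ne_of_mem_erase hx)
    · rintro ⟨a, b⟩ ⟨c, d⟩ h
      simp_all
  have hmemL : ∀ p ∈ L, p.2 < p.1 ∧ p ∈ P ∧ p.swap ∈ P := by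
    rintro ⟨a, b⟩ hp
    simp only [hL, Finset.mem_image, Finset.mem_sigma, Finset.mem_erase, Prod.mk.injEq] at hp
    obtain ⟨⟨a', b'⟩, ⟨⟨h₁, h₂⟩, h₃⟩, rfl, rfl⟩ := hp
    obtain ⟨h₄, h₅, h₆⟩ := hTR a' h₂ h₁ b' h₃
    refine ⟨h₄, Finset.mem_image.2 ⟨(⟨a', h₂⟩, ⟨b', h₅⟩), ?_, rfl⟩,
      Finset.mem_image.2 ⟨(⟨b', h₅⟩, ⟨a', h₂⟩), ?_, rfl⟩⟩
    · simpa [adjPairs] using h₆ h₂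
    · simpa [adjPairs] using (h₆ h₂).symm
  -- Pairs in `L` are strictly decreasing, so each edge counted there yields two distinct ordered
  -- pairs.
  have hdisj : Disjoint L (L.image Prod.swap) := by
    rw [Finset.disjoint_left]
    rintro p hp hp'
    obtain ⟨q, hq, rfl⟩ := Finset.mem_image.1 hp'
    have h₁ := (hmemL _ hp).1
    have h₂ := (hmemL _ hq).1
    simp only [Prod.fst_swap, Prod.snd_swap] at h₁
    omega
  have hsub : L ∪ L.image Prod.swap ⊆ P := by
    refine Finset.union_subset (fun p hp => (hmemL p hp).2.1) fun p hp => ?_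
    obtain ⟨q, hq, rfl⟩ := Finset.mem_image.1 hp
    exact (hmemL q hq).2.2
  have h₁ := Finset.card_le_card hsub
  rw [Finset.card_union_of_disjoint hdisj, Finset.card_image_of_injective _ Prod.swap_injective] at h₁
  obtain ⟨q, hq⟩ : ∃ q, R.card = q + 2 := ⟨R.card - 2, by omega⟩
  rw [hq] at hLcard ⊢
  have : q + 2 - 1 = q + 1 := rfl
  rw [this] at hLcard
  change 2 * m * (q + 2) ≤ _
  -- Counting both orders makes up for the exceptional vertex `o`, because there are at least two
  -- vertices.
  have h₂ : 2 * m * (q + 2) ≤ 2 * ((q + 1) * (2 * m)) := by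
    nlinarith [Nat.zero_le (m * q)]
  omega

end Density

end DefectiveColouring

namespace DefectiveColouring

/-! ### Removing marks from a forest by parity -/

section Forest

/-- The root of the tree of `x` in the forest on `ℕ` in which the parent of `x` is `par x` if
`par x < x`, and `x` is a root otherwise. -/
def treeRoot (par : ℕ → ℕ) (x : ℕ) : ℕ :=
  if par x < x then treeRoot par (par x) else x
termination_by x

/-- The number of elements of `M` among `x` and its ancestors. -/
def markCount (par : ℕ → ℕ) (M : Finset ℕ) (x : ℕ) : ℕ :=
  (if x ∈ M then 1 else 0) + (if par x < x then markCount par M (par x) else 0)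
termination_by x

variable {par : ℕ → ℕ} {M : Finset ℕ}

lemma treeRoot_of_lt {x : ℕ} (h : par x < x) : treeRoot par x = treeRoot par (par x) := by
  rw [treeRoot, if_pos h]

lemma treeRoot_of_not_lt {x : ℕ} (h : ¬ par x < x) : treeRoot par x = x := by
  rw [treeRoot, if_neg h]

lemma treeRoot_le (x : ℕ) : treeRoot par x ≤ x := by
  induction x using Nat.strong_induction_on with
  | _ x ih =>
    by_cases h : par x < x
    · rw [treeRoot_of_lt h]
      exact (ih _ h).trans h.le
    · rw [treeRoot_of_not_lt h]

lemma not_par_treeRoot_lt (x : ℕ) : ¬ par (treeRoot par x) < treeRoot par x := by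
  induction x using Nat.strong_induction_on with
  | _ x ih =>
    by_cases h : par x < x
    · rw [treeRoot_of_lt h]
      exact ih _ h
    · rwa [treeRoot_of_not_lt h]

lemma markCount_of_lt {x : ℕ} (h : par x < x) :
    markCount par M x = (if x ∈ M then 1 else 0) + markCount par M (par x) := by
  rw [markCount, if_pos h]

lemma markCount_of_not_lt {x : ℕ} (h : ¬ par x < x) :
    markCount par M x = if x ∈ M then 1 else 0 := by
  rw [markCount, if_neg h, Nat.add_zero]

lemma markCount_pos {x : ℕ} (h : x ∈ M) : 0 < markCount par M x := by
  rw [markCount, if_pos h]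
  omega

lemma exists_mark_of_markCount_pos (x : ℕ) :
    0 < markCount par M x → ∃ a ∈ M, a ≤ x ∧ treeRoot par a = treeRoot par x := by
  induction x using Nat.strong_induction_on with
  | _ x ih =>
    intro hx
    by_cases hM : x ∈ M
    · exact ⟨x, hM, le_rfl, rfl⟩
    · by_cases h : par x < x
      · rw [markCount_of_lt h, if_neg hM, Nat.zero_add] at hx
        obtain ⟨a, ha, hax, hr⟩ := ih _ h hx
        exact ⟨a, ha, hax.trans h.le, hr.trans (treeRoot_of_lt h).symm⟩
      · rw [markCount_of_not_lt h, if_neg hM] at hx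
        exact absurd hx (lt_irrefl _)

/-- In a forest with many more marks than trees that contain a mark one can remove `ℓ` marks
such that the parent of each of them is still connected to a remaining mark. -/
lemma exists_removable_marks {p ℓ : ℕ} (hMp : ∀ a ∈ M, a ≤ p)
    (hcard : (M.image (treeRoot par)).card + 2 * ℓ ≤ M.card) :
    ∃ I ⊆ M, I.card = ℓ ∧ (∀ a ∈ I, par a < a) ∧ ∀ P : ℕ → Prop, (∀ a ∈ M, a ∉ I → P a) →
      (∀ x ≤ p, par x < x → x ∉ I → par x ∉ I → (P x ↔ P (par x))) → ∀ a ∈ I, P (par a) := by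
  classical
  -- The least mark of each marked tree. These are spared when the odd marks are removed.
  set A := M.filter fun a => ∀ b ∈ M, treeRoot par b = treeRoot par a → a ≤ b with hA
  have hAcard : A.card ≤ (M.image (treeRoot par)).card := by
    refine Finset.card_le_card_of_injOn (treeRoot par)
      (fun a ha => Finset.mem_coe.2 (Finset.mem_image_of_mem _ (Finset.mem_filter.1 ha).1)) ?_
    intro a ha b hb hab
    have ha := Finset.mem_filter.1 ha
    have hb := Finset.mem_filter.1 hb
    exact le_antisymm (ha.2 b hb.1 hab.symm) (hb.2 a ha.1 hab)
  set I₁ := M.filter fun a => Even (markCount par M a) with hI₁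
  set I₀ := (M.filter fun a => ¬ Even (markCount par M a)) \ A with hI₀
  have h₁ := Finset.card_filter_add_card_filter_not (s := M) fun a => Even (markCount par M a)
  have h₂ := Finset.le_card_sdiff A (M.filter fun a => ¬ Even (markCount par M a))
  -- The two classes together miss at most one mark per marked tree, so one of them has `ℓ`
  -- elements.
  have hcases : ℓ ≤ I₁.card ∨ ℓ ≤ I₀.card := by
    rw [hI₁, hI₀]
    omega
  rcases hcases with h | h
  · obtain ⟨I, hI, hIc⟩ := Finset.exists_subset_card_eq h
    have hmem : ∀ a ∈ I, a ∈ M ∧ Even (markCount par M a) := fun a ha => Finset.mem_filter.1 (hI ha)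
    have hlt : ∀ a ∈ I, par a < a := by
      intro a ha
      by_contra hn
      have := (hmem a ha).2
      rw [markCount_of_not_lt hn, if_pos (hmem a ha).1] at this
      exact absurd this (by decide)
    refine ⟨I, fun a ha => (hmem a ha).1, hIc, hlt, fun P hP hstep => ?_⟩
    -- The parent of an even mark has odd count. Climbing from it through unmarked vertices ends at
    -- an odd mark, which is kept.
    have key : ∀ x, x ≤ p → ¬ Even (markCount par M x) → P x := by
      intro x
      induction x using Nat.strong_induction_on with
      | _ x ih =>
        intro hxp hx
        have hxI : x ∉ I := fun h => hx (hmem x h).2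
        by_cases hM : x ∈ M
        · exact hP x hM hxI
        · by_cases hl : par x < x
          · rw [markCount_of_lt hl, if_neg hM, Nat.zero_add] at hx
            exact (hstep x hxp hl hxI fun h => hx (hmem _ h).2).2 (ih _ hl (hl.le.trans hxp) hx)
          · rw [markCount_of_not_lt hl, if_neg hM] at hx
            exact absurd (by decide) hx
    intro a ha
    refine key _ ((hlt a ha).le.trans (hMp a (hmem a ha).1)) fun he => ?_
    have := (hmem a ha).2
    rw [markCount_of_lt (hlt a ha), if_pos (hmem a ha).1] at this
    grind
  · obtain ⟨I, hI, hIc⟩ := Finset.exists_subset_card_eq h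
    have hmem : ∀ a ∈ I, a ∈ M ∧ ¬ Even (markCount par M a) ∧ a ∉ A := fun a ha => by
      have := Finset.mem_sdiff.1 (hI ha)
      exact ⟨(Finset.mem_filter.1 this.1).1, (Finset.mem_filter.1 this.1).2, this.2⟩
    have hsmaller : ∀ a ∈ I, ∃ b ∈ A, treeRoot par b = treeRoot par a ∧ b < a := by
      intro a ha
      obtain ⟨haM, -, haA⟩ := hmem a ha
      have hne : (M.filter fun b => treeRoot par b = treeRoot par a).Nonempty :=
        ⟨a, Finset.mem_filter.2 ⟨haM, rfl⟩⟩
      have hm := Finset.mem_filter.1 (Finset.min'_mem _ hne)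
      have hmin : ∀ c ∈ M, treeRoot par c = treeRoot par a → Finset.min' _ hne ≤ c :=
        fun c hc hca => Finset.min'_le _ _ (Finset.mem_filter.2 ⟨hc, hca⟩)
      have hbA : Finset.min' _ hne ∈ A :=
        Finset.mem_filter.2 ⟨hm.1, fun c hc hcb => hmin c hc (hcb.trans hm.2)⟩
      exact ⟨_, hbA, hm.2, lt_of_le_of_ne (hmin a haM rfl) fun h => haA (h ▸ hbA)⟩
    have hlt : ∀ a ∈ I, par a < a := by
      intro a ha
      by_contra hn
      obtain ⟨b, -, hb, hba⟩ := hsmaller a ha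
      rw [treeRoot_of_not_lt hn] at hb
      have := treeRoot_le (par := par) b
      omega
    refine ⟨I, fun a ha => (hmem a ha).1, hIc, hlt, fun P hP hstep => ?_⟩
    have hzero : ∀ x, markCount par M x = 0 → x ∉ M :=
      fun x hx h => (markCount_pos h).ne' hx
    have keyRoot : ∀ x, x ≤ p → markCount par M x = 0 → (P x ↔ P (treeRoot par x)) := by
      intro x
      induction x using Nat.strong_induction_on with
      | _ x ih =>
        intro hxp hx
        by_cases hl : par x < x
        · have hx' : markCount par M (par x) = 0 := by
            rw [markCount_of_lt hl] at hx
            omega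
          rw [treeRoot_of_lt hl, ← ih _ hl (hl.le.trans hxp) hx']
          exact hstep x hxp hl (fun h => hzero x hx (hmem _ h).1) fun h => hzero _ hx' (hmem _ h).1
        · rw [treeRoot_of_not_lt hl]
    have key : ∀ x, x ≤ p → Even (markCount par M x) → 0 < markCount par M x → P x := by
      intro x
      induction x using Nat.strong_induction_on with
      | _ x ih =>
        intro hxp hx hpos
        have hxI : x ∉ I := fun h => (hmem x h).2.1 hx
        by_cases hM : x ∈ M
        · exact hP x hM hxI
        · by_cases hl : par x < x
          · rw [markCount_of_lt hl, if_neg hM, Nat.zero_add] at hx hpos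
            exact (hstep x hxp hl hxI fun h => (hmem _ h).2.1 hx).2
              (ih _ hl (hl.le.trans hxp) hx hpos)
          · rw [markCount_of_not_lt hl, if_neg hM] at hpos
            exact absurd hpos (lt_irrefl _)
    -- No mark lies above the least mark of a tree, so from it one climbs to the root without
    -- meeting a removed vertex.
    have rootA : ∀ b ∈ A, P (treeRoot par b) := by
      intro b hb
      obtain ⟨hbM, hbmin⟩ := Finset.mem_filter.1 hb
      have hbI : b ∉ I := fun h => (hmem b h).2.2 hb
      have hPb := hP b hbM hbI
      by_cases hl : par b < b
      · have hz : markCount par M (par b) = 0 := by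
          by_contra hne
          obtain ⟨c, hc, hcb, hr⟩ := exists_mark_of_markCount_pos _ (Nat.pos_of_ne_zero hne)
          have := hbmin c hc (hr.trans (treeRoot_of_lt hl).symm)
          omega
        have := (hstep b (hMp b hbM) hl hbI fun h => hzero _ hz (hmem _ h).1).1 hPb
        rw [treeRoot_of_lt hl]
        exact (keyRoot _ (hl.le.trans (hMp b hbM)) hz).1 this
      · rwa [treeRoot_of_not_lt hl]
    intro a ha
    have hap : par a ≤ p := (hlt a ha).le.trans (hMp a (hmem a ha).1)
    have hc := markCount_of_lt (M := M) (hlt a ha)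
    rw [if_pos (hmem a ha).1] at hc
    -- The parent of a removed odd mark has even count. If the count is zero, the way leads over the
    -- root to the least mark of the tree; otherwise it leads up to a kept even mark.
    rcases Nat.eq_zero_or_pos (markCount par M (par a)) with hz | hpos
    · obtain ⟨b, hb, hr, -⟩ := hsmaller a ha
      rw [keyRoot _ hap hz, ← treeRoot_of_lt (hlt a ha), ← hr]
      exact rootA b hb
    · refine key _ hap ?_ hpos
      have := (hmem a ha).2.1
      rw [hc] at this
      grind

end Forest

end DefectiveColouring

namespace DefectiveColouring

/-! ### Links between hubs, and cutting out star centres -/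

section Links

variable {V : Type*}

/-- The least index of a neighbour of `b` in the sequence `w`. -/
noncomputable def firstNbr (G : SimpleGraph V) (w : ℕ → V) (b : V) : ℕ :=
  sInf {j | G.Adj b (w j)}

lemma adj_firstNbr {G : SimpleGraph V} {w : ℕ → V} {b : V} {j : ℕ} (h : G.Adj b (w j)) :
    G.Adj b (w (firstNbr G w b)) :=
  Nat.sInf_mem (s := {j | G.Adj b (w j)}) ⟨j, h⟩

lemma firstNbr_le {G : SimpleGraph V} {w : ℕ → V} {b : V} {j : ℕ} (h : G.Adj b (w j)) :
    firstNbr G w b ≤ j :=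
  Nat.sInf_le h

open Classical in
/-- The common neighbours of `w i` and `w j` outside `w 0, …, w p` whose first neighbour in the
sequence is `w j`. -/
noncomputable def links [Fintype V] (G : SimpleGraph V) (w : ℕ → V) (p i j : ℕ) : Finset V :=
  Finset.univ.filter fun b =>
    (∀ a ≤ p, w a ≠ b) ∧ G.Adj b (w i) ∧ G.Adj b (w j) ∧ firstNbr G w b = j

lemma mem_links [Fintype V] {G : SimpleGraph V} {w : ℕ → V} {p i j : ℕ} {b : V} :
    b ∈ links G w p i j ↔
      (∀ a ≤ p, w a ≠ b) ∧ G.Adj b (w i) ∧ G.Adj b (w j) ∧ firstNbr G w b = j := by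
  simp [links]

/-- Otherwise `ℓ` marks can be removed from the forest so that their parents stay joined to `w ρ`
through remaining marks. The removed marks become centres, and their links to their parents become
leaves. Since every parent edge has more than `ℓ * k` links, one link of each remains unused and
keeps the forest connected. -/
lemma card_marks_lt [Fintype V] {G : SimpleGraph V} {ℓ k : ℕ}
    (hG : ¬ IsMinor (dominatedStars ℓ k) G) {w : ℕ → V} {p : ℕ} {par : ℕ → ℕ}
    (hw : ∀ i ≤ p, ∀ j ≤ p, w i = w j → i = j)
    (hpar : ∀ x ≤ p, par x < x → ℓ * k + 1 ≤ (links G w p x (par x)).card)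
    {ρ : ℕ} (hρ : ρ ≤ p) {M : Finset ℕ} (hMp : ∀ a ∈ M, a ≤ p) (hρM : ρ ∉ M)
    (hM : ∀ a ∈ M, G.Adj (w ρ) (w a) ∨ ∃ b, b ∈ links G w p ρ a) :
    M.card < (M.image (treeRoot par)).card + 2 * ℓ := by
  classical
  by_contra hcon
  obtain ⟨I, hIM, hIc, hlt, hI⟩ := exists_removable_marks hMp (not_lt.1 hcon)
  have hIp : ∀ a ∈ I, a ≤ p := fun a ha => hMp a (hIM ha)
  have hbm : ∀ a, ∃ b, a ∈ M → G.Adj (w ρ) (w a) ∨ b ∈ links G w p ρ a := by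
    intro a
    by_cases ha : a ∈ M
    · rcases hM a ha with h | ⟨b, hb⟩
      · exact ⟨w a, fun _ => Or.inl h⟩
      · exact ⟨b, fun _ => Or.inr hb⟩
    · exact ⟨w a, fun h => absurd h ha⟩
  choose bm hbm using hbm
  set e := I.equivFinOfCardEq hIc
  set c : Fin ℓ → ℕ := fun i => (e.symm i : ℕ) with hc
  have hcI : ∀ i, c i ∈ I := fun i => (e.symm i).2
  have hcsurj : ∀ a ∈ I, ∃ i, c i = a := fun a ha => ⟨e ⟨a, ha⟩, by simp [hc]⟩
  have hcinj : Function.Injective c := Subtype.val_injective.comp e.symm.injective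
  have hpp : ∀ i, par (c i) ≤ p := fun i => (hlt _ (hcI i)).le.trans (hIp _ (hcI i))
  -- A leaf of `c i` has first neighbour `par (c i)`, so the only connector from `ρ` that it could
  -- coincide with is `bm (par (c i))`. Erasing that one vertex still leaves `ℓ * k` links.
  obtain ⟨lf, hlf, hlfA⟩ := exists_injective_prod_of_le_card (ℓ := ℓ) (k := k)
    (fun i => (links G w p (c i) (par (c i))).erase (bm (par (c i)))) (by
      intro i
      have h₁ := hpar _ (hIp _ (hcI i)) (hlt _ (hcI i))
      have h₂ := Finset.pred_card_le_card_erase (s := links G w p (c i) (par (c i)))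
        (a := bm (par (c i)))
      omega)
  simp only [Finset.mem_erase, mem_links] at hlfA
  set S : Set V := {z | (∀ i, w (c i) ≠ z) ∧ ∀ x, lf x ≠ z} with hS
  have hwS : ∀ x ≤ p, x ∉ I → w x ∈ S := by
    refine fun x hx hxI => ⟨fun i hi => hxI ?_, fun y hy => (hlfA y.1 y.2).2.1 x hx hy.symm⟩
    rw [← hw _ (hIp _ (hcI i)) _ hx hi]
    exact hcI i
  have hbS : ∀ b, (∀ a ≤ p, w a ≠ b) → (∀ x, lf x ≠ b) → b ∈ S :=
    fun b hb hl => ⟨fun i => hb _ (hIp _ (hcI i)), hl⟩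
  have hlink : ∀ x ≤ p, par x < x → ∃ b ∈ S, G.Adj b (w x) ∧ G.Adj b (w (par x)) := by
    intro x hx hpx
    have hcard : (Finset.univ.image lf).card ≤ ℓ * k := by
      simpa using Finset.card_image_le (s := Finset.univ) (f := lf)
    have h₁ := hpar x hx hpx
    obtain ⟨b, hb, hbl⟩ := Finset.exists_mem_notMem_of_card_lt_card
      (lt_of_le_of_lt hcard (Nat.lt_of_succ_le h₁))
    obtain ⟨hb₁, hb₂, hb₃, -⟩ := mem_links.1 hb
    refine ⟨b, hbS b hb₁ fun x hx => hbl ?_, hb₂, hb₃⟩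
    exact Finset.mem_image.2 ⟨x, Finset.mem_univ _, hx⟩
  have hρI : ρ ∉ I := fun h => hρM (hIM h)
  have hjoin : ∀ a ∈ I, Joined G S (w ρ) (w (par a)) := by
    refine hI (fun x => Joined G S (w ρ) (w x)) ?_ ?_
    · intro a ha haI
      have haS := hwS a (hMp a ha) haI
      rcases hbm a ha with h | h
      · exact Relation.ReflTransGen.single ⟨h, haS⟩
      · obtain ⟨h₁, h₂, h₃, h₄⟩ := mem_links.1 h
        refine Joined.step (Relation.ReflTransGen.single ⟨h₂.symm, hbS _ h₁ ?_⟩) h₃ haS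
        rintro ⟨i, j⟩ hij
        obtain ⟨h₅, h₆, h₇, h₈, h₉⟩ := hlfA i j
        rw [hij] at h₅ h₉
        exact h₅ (by rw [← h₉, h₄])
    · intro x hx hpx hxI hpI
      obtain ⟨b, hb, hb₁, hb₂⟩ := hlink x hx hpx
      exact ⟨fun h => (h.step hb₁.symm hb).step hb₂ (hwS _ (hpx.le.trans hx) hpI),
        fun h => (h.step hb₂.symm hb).step hb₁ (hwS _ hx hxI)⟩
  refine hG (isMinor_dominatedStars_of_joined (w ρ) (fun i => w (c i)) lf ?_ hlf ?_ ?_ ?_ ?_ ?_ ?_)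
  · exact fun i j hij => hcinj (hw _ (hIp _ (hcI i)) _ (hIp _ (hcI j)) hij)
  · exact fun i x => (hlfA x.1 x.2).2.1 _ (hIp _ (hcI i))
  · exact (hwS ρ hρ hρI).1
  · exact (hwS ρ hρ hρI).2
  · exact fun i j => (hlfA i j).2.2.1.symm
  · intro i
    obtain ⟨b, hb, hb₁, hb₂⟩ := hlink _ (hIp _ (hcI i)) (hlt _ (hcI i))
    exact ⟨b, hb₁.symm, (hjoin _ (hcI i)).step hb₂.symm hb⟩
  · exact fun x => ⟨_, (hlfA x.1 x.2).2.2.2.1, hjoin _ (hcI x.1)⟩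

end Links

end DefectiveColouring

namespace DefectiveColouring

/-! ### The forest of hubs and the degree bound inside it -/

section Links

variable {V : Type*}

/-- The vertices of the tree with root `a`, each with the vertices outside `w 0, …, w p` of which
it is the first neighbour. -/
def treeSet (G : SimpleGraph V) (w : ℕ → V) (p : ℕ) (par : ℕ → ℕ) (a : ℕ) : Set V :=
  {v | ∃ x ≤ p, treeRoot par x = a ∧
    (v = w x ∨ ((∀ i ≤ p, w i ≠ v) ∧ firstNbr G w v = x ∧ G.Adj v (w x)))}

lemma mem_treeSet {G : SimpleGraph V} {w : ℕ → V} {p : ℕ} {par : ℕ → ℕ} {x : ℕ} (hx : x ≤ p) :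
    w x ∈ treeSet G w p par (treeRoot par x) :=
  ⟨x, hx, rfl, Or.inl rfl⟩

lemma link_mem_treeSet [Fintype V] {G : SimpleGraph V} {w : ℕ → V} {p : ℕ} {par : ℕ → ℕ} {i j : ℕ}
    (hj : j ≤ p) {b : V} (hb : b ∈ links G w p i j) : b ∈ treeSet G w p par (treeRoot par j) := by
  obtain ⟨h₁, h₂, h₃, h₄⟩ := mem_links.1 hb
  exact ⟨j, hj, rfl, Or.inr ⟨h₁, h₄, h₃⟩⟩

/-- A link between `x` and `par x` has `par x` as first neighbour, so it belongs to the set of the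
same tree. -/
lemma connected_treeSet [Fintype V] {G : SimpleGraph V} {w : ℕ → V} {p : ℕ} {par : ℕ → ℕ}
    (hpar : ∀ x ≤ p, par x < x → (links G w p x (par x)).Nonempty) {a : ℕ} (ha : a ≤ p)
    (hroot : ¬ par a < a) : (G.induce (treeSet G w p par a)).Connected := by
  have hmem : ∀ x ≤ p, treeRoot par x = a → w x ∈ treeSet G w p par a :=
    fun x hx hxa => hxa ▸ mem_treeSet hx
  have key : ∀ x ≤ p, treeRoot par x = a → Joined G (treeSet G w p par a) (w a) (w x) := by
    intro x
    induction x using Nat.strong_induction_on with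
    | _ x ih =>
      intro hx hxa
      by_cases hl : par x < x
      · have hxa' := hxa
        rw [treeRoot_of_lt hl] at hxa'
        obtain ⟨b, hb⟩ := hpar x hx hl
        obtain ⟨h₁, h₂, h₃, h₄⟩ := mem_links.1 hb
        have hbT := link_mem_treeSet (par := par) (hl.le.trans hx) hb
        rw [hxa'] at hbT
        exact ((ih _ hl (hl.le.trans hx) hxa').step h₃.symm hbT).step h₂ (hmem x hx hxa)
      · rw [treeRoot_of_not_lt hl] at hxa
        rw [hxa]
        exact Relation.ReflTransGen.refl
  refine connected_of_joined (hmem a ha (treeRoot_of_not_lt hroot)) ?_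
  rintro v ⟨x, hx, hxa, rfl | ⟨h₁, h₂, h₃⟩⟩
  · exact key x hx hxa
  · exact (key x hx hxa).step h₃.symm ⟨x, hx, hxa, Or.inr ⟨h₁, h₂, h₃⟩⟩

lemma disjoint_treeSet {G : SimpleGraph V} {w : ℕ → V} {p : ℕ} {par : ℕ → ℕ}
    (hw : ∀ i ≤ p, ∀ j ≤ p, w i = w j → i = j) {a b : ℕ} (hab : a ≠ b) :
    Disjoint (treeSet G w p par a) (treeSet G w p par b) := by
  rw [Set.disjoint_left]
  rintro v ⟨x, hx, rfl, hv⟩ ⟨y, hy, rfl, hv'⟩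
  refine hab (congrArg _ ?_)
  rcases hv with rfl | ⟨h₁, h₂, -⟩ <;> rcases hv' with h | ⟨h₃, h₄, -⟩
  · exact hw _ hx _ hy h
  · exact absurd rfl (h₃ x hx)
  · exact absurd h.symm (h₁ y hy)
  · exact h₂.symm.trans h₄

/-- The bound on the number of links that each vertex of a sequence of hubs needs. -/
def linkBound (ℓ k : ℕ) : ℕ := (2 * (ℓ * (k + 1)) + 2 * ℓ) * (ℓ * k + 1)

open Classical in
-- The parent is an earlier hub sharing at least `ℓ * k + 1` links. If there is none, `par x = x`
-- and each earlier hub accounts for at most `ℓ * k` witnesses, so by the choice of `linkBound` many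
-- earlier hubs are needed.
lemma exists_parents [Fintype V] {G : SimpleGraph V} {ℓ k : ℕ} {w : ℕ → V} {p : ℕ}
    (hwit : ∀ i ≤ p, 0 < i → linkBound ℓ k ≤ (Finset.univ.filter fun b =>
      (∀ a ≤ p, w a ≠ b) ∧ G.Adj b (w i) ∧ ∃ j < i, G.Adj b (w j)).card) :
    ∃ par : ℕ → ℕ, (∀ x ≤ p, par x < x → ℓ * k + 1 ≤ (links G w p x (par x)).card) ∧
      ∀ x ≤ p, 0 < x → ¬ par x < x → 2 * (ℓ * (k + 1)) + 2 * ℓ ≤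
        ((Finset.range x).filter fun j => (links G w p x j).Nonempty).card := by
  have hch : ∀ x, ∃ j, (j < x ∧ ℓ * k + 1 ≤ (links G w p x j).card) ∨
      (j = x ∧ ∀ i < x, (links G w p x i).card ≤ ℓ * k) := by
    intro x
    by_cases h : ∃ j < x, ℓ * k + 1 ≤ (links G w p x j).card
    · obtain ⟨j, hj⟩ := h
      exact ⟨j, Or.inl hj⟩
    · push Not at h
      exact ⟨x, Or.inr ⟨rfl, fun i hi => Nat.le_of_lt_succ (h i hi)⟩⟩
  choose par hpar using hch
  refine ⟨par, fun x _ hl => ?_, fun x hxp hx hl => ?_⟩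
  · rcases hpar x with h | h
    · exact h.2
    · omega
  · have hsmall := ((hpar x).resolve_left fun h => hl h.1).2
    set T := (Finset.range x).filter fun j => (links G w p x j).Nonempty with hT
    -- Each witness is counted at its first neighbour, which precedes `x`.
    have hsub : (Finset.univ.filter fun b =>
        (∀ a ≤ p, w a ≠ b) ∧ G.Adj b (w x) ∧ ∃ j < x, G.Adj b (w j)) ⊆
        T.biUnion fun j => links G w p x j := by
      intro b hb
      obtain ⟨-, h₁, h₂, j, hj, h₃⟩ := Finset.mem_filter.1 hb
      have hmem : b ∈ links G w p x (firstNbr G w b) :=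
        mem_links.2 ⟨h₁, h₂, adj_firstNbr h₃, rfl⟩
      exact Finset.mem_biUnion.2 ⟨_, Finset.mem_filter.2
        ⟨Finset.mem_range.2 ((firstNbr_le h₃).trans_lt hj), ⟨b, hmem⟩⟩, hmem⟩
    have h₁ := (hwit x hxp hx).trans ((Finset.card_le_card hsub).trans
      (Finset.card_biUnion_le_card_mul T _ (ℓ * k) fun j hj =>
        hsmall j (Finset.mem_range.1 (Finset.mem_filter.1 hj).1)))
    by_contra hlt
    rw [not_le] at hlt
    have h₂ : T.card * (ℓ * k) ≤ T.card * (ℓ * k + 1) := Nat.mul_le_mul_left _ (Nat.le_succ _)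
    have h₃ : T.card * (ℓ * k + 1) < linkBound ℓ k :=
      Nat.mul_lt_mul_of_pos_right hlt (Nat.succ_pos _)
    omega

open Classical in
lemma card_neighbours_in_hubs_le_of_links [Fintype V] {G : SimpleGraph V} {ℓ k : ℕ} (hℓ : 1 ≤ ℓ)
    (hG : ¬ IsMinor (dominatedStars ℓ k) G) {w : ℕ → V} {p : ℕ}
    (hw : ∀ i ≤ p, ∀ j ≤ p, w i = w j → i = j)
    (hwit : ∀ i ≤ p, 0 < i → linkBound ℓ k ≤ (Finset.univ.filter fun b =>
      (∀ a ≤ p, w a ≠ b) ∧ G.Adj b (w i) ∧ ∃ j < i, G.Adj b (w j)).card)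
    {ρ : ℕ} (hρ : ρ ≤ p) :
    ((Finset.range (p + 1)).filter fun a => G.Adj (w ρ) (w a)).card ≤ 2 * ℓ := by
  obtain ⟨par, hpar, hspread⟩ := exists_parents hwit
  set R := (Finset.range (p + 1)).filter fun x => ¬ par x < x with hR
  have hrootR : ∀ x ≤ p, treeRoot par x ∈ R := fun x hx =>
    Finset.mem_filter.2 ⟨Finset.mem_range.2 (Nat.lt_succ_of_le ((treeRoot_le x).trans hx)),
      not_par_treeRoot_lt x⟩
  have hRp : ∀ x ∈ R, x ≤ p := fun x hx =>
    Nat.le_of_lt_succ (Finset.mem_range.1 (Finset.mem_filter.1 hx).1)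
  have h0 : 0 ∈ R := Finset.mem_filter.2 ⟨Finset.mem_range.2 (Nat.succ_pos _), Nat.not_lt_zero _⟩
  -- With two or more trees, contract each of them. By `card_marks_lt`, the links of a root other
  -- than `0` reach at least `2 * (ℓ * (k + 1))` trees; their roots are smaller, so the quotient is
  -- dense.
  have hRone : R.card ≤ 1 := by
    by_contra hcard
    let Q : SimpleGraph R :=
      { Adj := fun a b => a ≠ b ∧ ∃ x ∈ treeSet G w p par a, ∃ y ∈ treeSet G w p par b, G.Adj x y
        symm := ⟨fun _ _ h => ⟨h.1.symm, by
          obtain ⟨-, x, hx, y, hy, hxy⟩ := h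
          exact ⟨y, hy, x, hx, hxy.symm⟩⟩⟩
        loopless := ⟨fun _ h => h.1 rfl⟩ }
    have hQ : IsMinor Q G := by
      refine ⟨fun a => treeSet G w p par a, fun a => ?_, fun a b hab => ?_, fun a b hab => hab.2⟩
      · exact connected_treeSet (fun x hx hl => Finset.card_pos.1
          (lt_of_lt_of_le (Nat.succ_pos _) (hpar x hx hl))) (hRp _ a.2) (Finset.mem_filter.1 a.2).2
      · exact disjoint_treeSet hw fun h => hab (Subtype.ext h)
    refine hG (IsMinor.trans ?_ hQ)
    refine isMinor_dominatedStars_of_lower_neighbours hℓ h0 (not_le.1 hcard) Q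
      (fun x => ((Finset.range x).filter fun j => (links G w p x j).Nonempty).image (treeRoot par))
      (fun x hx hx0 => ?_) (fun x hx hx0 t ht => ?_)
    · have h₁ := hspread x (hRp x hx) (Nat.pos_of_ne_zero hx0) (Finset.mem_filter.1 hx).2
      have h₂ := card_marks_lt hG hw hpar (hRp x hx)
        (M := (Finset.range x).filter fun j => (links G w p x j).Nonempty)
        (fun a ha => (Finset.mem_range.1 (Finset.mem_filter.1 ha).1).le.trans (hRp x hx))
        (fun h => lt_irrefl _ (Finset.mem_range.1 (Finset.mem_filter.1 h).1))
        (fun a ha => Or.inr (Finset.mem_filter.1 ha).2)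
      omega
    · obtain ⟨j, hj, rfl⟩ := Finset.mem_image.1 ht
      obtain ⟨hjx, b, hb⟩ := Finset.mem_filter.1 hj
      rw [Finset.mem_range] at hjx
      have hlt : treeRoot par j < x := (treeRoot_le j).trans_lt hjx
      have hjp := hjx.le.trans (hRp x hx)
      refine ⟨hlt, hrootR j hjp, fun _ => ⟨fun h => hlt.ne' (congrArg Subtype.val h), ?_⟩⟩
      have hxT := mem_treeSet (G := G) (w := w) (par := par) (hRp x hx)
      rw [treeRoot_of_not_lt (Finset.mem_filter.1 hx).2] at hxT
      exact ⟨w x, hxT, b, link_mem_treeSet hjp hb, (mem_links.1 hb).2.1.symm⟩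
  -- With a single tree, the bound applied to the hub neighbours of `w ρ` reads `M.card < 1 + 2 *
  -- ℓ`.
  have h₁ := card_marks_lt hG hw hpar hρ
    (M := (Finset.range (p + 1)).filter fun a => G.Adj (w ρ) (w a))
    (fun a ha => Nat.le_of_lt_succ (Finset.mem_range.1 (Finset.mem_filter.1 ha).1))
    (fun h => (Finset.mem_filter.1 h).2.ne rfl)
    (fun a ha => Or.inl (Finset.mem_filter.1 ha).2)
  have h₂ : (((Finset.range (p + 1)).filter fun a => G.Adj (w ρ) (w a)).image
      (treeRoot par)).card ≤ R.card := by
    refine Finset.card_le_card fun t ht => ?_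
    obtain ⟨a, ha, rfl⟩ := Finset.mem_image.1 ht
    exact hrootR a (Nat.le_of_lt_succ (Finset.mem_range.1 (Finset.mem_filter.1 ha).1))
  omega

/-- `w 0, …, w p` are distinct, and each `w i` with `i > 0` has at least `s` neighbours outside
`w 0, …, w (i - 1)` that have a neighbour among `w 0, …, w (i - 1)`. -/
def IsHubSequence (G : SimpleGraph V) (s : ℕ) (w : ℕ → V) (p : ℕ) : Prop :=
  (∀ i ≤ p, ∀ j ≤ p, w i = w j → i = j) ∧ ∀ i ≤ p, 0 < i →
    s ≤ {b | (∀ a < i, w a ≠ b) ∧ G.Adj b (w i) ∧ ∃ j < i, G.Adj b (w j)}.ncard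

open Classical in
-- The witnesses of a hub may themselves become hubs later. By induction at most `2 * ℓ` of them do
-- so up to index `p`, and the newest hub is at most one more; the surplus `2 * ℓ + 1` over
-- `linkBound` pays for this.
lemma card_neighbours_in_hubs_le [Fintype V] {G : SimpleGraph V} {ℓ k : ℕ} (hℓ : 1 ≤ ℓ)
    (hG : ¬ IsMinor (dominatedStars ℓ k) G) {w : ℕ → V} (p : ℕ)
    (hw : IsHubSequence G (linkBound ℓ k + 2 * ℓ + 1) w p) :
    ∀ ρ ≤ p, ((Finset.range (p + 1)).filter fun a => G.Adj (w ρ) (w a)).card ≤ 2 * ℓ := by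
  induction p with
  | zero =>
    intro ρ hρ
    refine (Finset.card_filter_le _ _).trans ?_
    rw [Finset.card_range]
    omega
  | succ p ih =>
    have ih' := ih ⟨fun i hi j hj => hw.1 i (hi.trans p.le_succ) j (hj.trans p.le_succ),
      fun i hi => hw.2 i (hi.trans p.le_succ)⟩
    intro ρ hρ
    refine card_neighbours_in_hubs_le_of_links hℓ hG hw.1 (fun i hi h0 => ?_) hρ
    have h₁ := hw.2 i hi h0
    set A := {b | (∀ a < i, w a ≠ b) ∧ G.Adj b (w i) ∧ ∃ j < i, G.Adj b (w j)} with hA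
    rw [Set.ncard_eq_toFinset_card' A] at h₁
    set B := (Finset.range (p + 1)).filter fun a => G.Adj (w i) (w a) with hB
    have hsub : A.toFinset ⊆ (Finset.univ.filter fun b =>
        (∀ a ≤ p + 1, w a ≠ b) ∧ G.Adj b (w i) ∧ ∃ j < i, G.Adj b (w j)) ∪
        (B.filter fun a => i < a).image w ∪ (if i ≤ p then {w (p + 1)} else ∅) := by
      intro b hb
      rw [Set.mem_toFinset] at hb
      obtain ⟨hb₁, hb₂, hb₃⟩ := hb
      by_cases hout : ∀ a ≤ p + 1, w a ≠ b
      · simp only [Finset.mem_union, Finset.mem_filter, Finset.mem_univ, true_and]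
        exact Or.inl (Or.inl ⟨hout, hb₂, hb₃⟩)
      · push Not at hout
        obtain ⟨a, ha, rfl⟩ := hout
        have hia : i ≤ a := not_lt.1 fun h => hb₁ a h rfl
        have hne : a ≠ i := fun h => hb₂.ne (by rw [h])
        rcases Nat.lt_or_ge p a with hpa | hpa
        · obtain rfl : a = p + 1 := by omega
          rw [if_pos (by omega)]
          simp
        · refine Finset.mem_union_left _ (Finset.mem_union_right _ (Finset.mem_image_of_mem _ ?_))
          rw [Finset.mem_filter, hB, Finset.mem_filter, Finset.mem_range]
          exact ⟨⟨by omega, hb₂.symm⟩, by omega⟩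
    have hBcard : ((B.filter fun a => i < a).image w).card ≤ 2 * ℓ := by
      rcases Nat.lt_or_ge p i with hpi | hpi
      · have : B.filter (fun a => i < a) = ∅ := by
          refine Finset.filter_eq_empty_iff.2 fun a ha => ?_
          have := Finset.mem_range.1 (Finset.mem_filter.1 ha).1
          omega
        rw [this, Finset.image_empty, Finset.card_empty]
        exact Nat.zero_le _
      · exact Finset.card_image_le.trans ((Finset.card_filter_le _ _).trans (ih' i hpi))
    have hone : (if i ≤ p then ({w (p + 1)} : Finset V) else ∅).card ≤ 1 := by
      split_ifs <;> simp
    have h₂ := Finset.card_le_card hsub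
    have h₃ := Finset.card_union_le ((Finset.univ.filter fun b =>
        (∀ a ≤ p + 1, w a ≠ b) ∧ G.Adj b (w i) ∧ ∃ j < i, G.Adj b (w j)) ∪
        (B.filter fun a => i < a).image w) (if i ≤ p then {w (p + 1)} else ∅)
    have h₄ := Finset.card_union_le (Finset.univ.filter fun b =>
        (∀ a ≤ p + 1, w a ≠ b) ∧ G.Adj b (w i) ∧ ∃ j < i, G.Adj b (w j))
        ((B.filter fun a => i < a).image w)
    omega

end Links

end DefectiveColouring

namespace DefectiveColouring

/-! ### Maximal hub sets and the rooted colouring -/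

section Colouring

variable {V : Type*}

/-- The common neighbours of `x` and the set `W` outside `W`. -/
def outerLinks (G : SimpleGraph V) (W : Set V) (x : V) : Set V :=
  {b | b ∉ W ∧ G.Adj x b ∧ ∃ u ∈ W, G.Adj b u}

/-- The vertices of `W` and their neighbours. -/
def closedNbhd (G : SimpleGraph V) (W : Set V) : Set V := {x | x ∈ W ∨ ∃ u ∈ W, G.Adj x u}

lemma IsHubSequence.lt_card [Fintype V] {G : SimpleGraph V} {s : ℕ} {w : ℕ → V} {p : ℕ}
    (h : IsHubSequence G s w p) : p < Fintype.card V := by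
  classical
  have := Finset.card_le_card_of_injOn (s := Finset.range (p + 1)) (t := Finset.univ) w
    (fun _ _ => Finset.mem_coe.2 (Finset.mem_univ _)) fun i hi j hj hij =>
      h.1 i (Nat.le_of_lt_succ (Finset.mem_range.1 hi)) j
        (Nat.le_of_lt_succ (Finset.mem_range.1 hj)) hij
  rw [Finset.card_range, Finset.card_univ] at this
  omega

lemma IsHubSequence.extend {G : SimpleGraph V} {s : ℕ} {w : ℕ → V} {p : ℕ}
    (h : IsHubSequence G s w p) {x : V} (hx : ∀ a ≤ p, w a ≠ x)
    (hs : s ≤ {b | (∀ a ≤ p, w a ≠ b) ∧ G.Adj b x ∧ ∃ j ≤ p, G.Adj b (w j)}.ncard) :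
    IsHubSequence G s (fun i => if i ≤ p then w i else x) (p + 1) := by
  refine ⟨fun i hi j hj hij => ?_, fun i hi h0 => ?_⟩
  · dsimp only at hij
    split_ifs at hij with h₁ h₂ h₂
    · exact h.1 i h₁ j h₂ hij
    · exact absurd hij (hx i h₁)
    · exact absurd hij.symm (hx j h₂)
    · omega
  · dsimp only
    split_ifs with h₁
    · convert h.2 i h₁ h0 using 4 with b
      refine and_congr (forall₂_congr fun a ha => ?_) (and_congr_right fun _ =>
        exists_congr fun j => and_congr_right fun hj => ?_)
      · rw [if_pos (ha.le.trans h₁)]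
      · rw [if_pos (hj.le.trans h₁)]
    · obtain rfl : i = p + 1 := by omega
      convert hs using 4 with b
      simp only [Nat.lt_succ_iff]
      refine and_congr (forall₂_congr fun a ha => ?_) (and_congr_right fun _ =>
        exists_congr fun j => and_congr_right fun hj => ?_)
      · rw [if_pos ha]
      · rw [if_pos hj]

/-- The sequence consisting of `r` alone qualifies, and the hubs are distinct, so a longest sequence
exists; extending it by a violating `x` would contradict maximality. -/
lemma exists_maximal_hubSequence [Fintype V] (G : SimpleGraph V) (s : ℕ) (r : V) :
    ∃ (w : ℕ → V) (p : ℕ), w 0 = r ∧ IsHubSequence G s w p ∧ ∀ x, (∀ a ≤ p, w a ≠ x) →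
      {b | (∀ a ≤ p, w a ≠ b) ∧ G.Adj b x ∧ ∃ j ≤ p, G.Adj b (w j)}.ncard < s := by
  classical
  let P : ℕ → Prop := fun p => ∃ w : ℕ → V, w 0 = r ∧ IsHubSequence G s w p
  have h0 : P 0 := ⟨fun _ => r, rfl, fun i hi j hj _ => by omega, fun i hi h0 => by omega⟩
  obtain ⟨w, hw0, hw⟩ : P (Nat.findGreatest P (Fintype.card V)) :=
    Nat.findGreatest_spec (Nat.zero_le _) h0
  refine ⟨w, _, hw0, hw, fun x hx => ?_⟩
  by_contra hs
  have hext := hw.extend hx (not_lt.1 hs)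
  have hP : P (Nat.findGreatest P (Fintype.card V) + 1) :=
    ⟨_, by rw [if_pos (Nat.zero_le _), hw0], hext⟩
  have := Nat.le_findGreatest hext.lt_card.le hP
  omega

/-- The bound on the number of neighbours of a vertex among the neighbours of a set of hubs. -/
def hubBound (ℓ k : ℕ) : ℕ := linkBound ℓ k + 2 * ℓ + 1

lemma exists_hubs [Finite V] {G : SimpleGraph V} {ℓ k : ℕ} (hℓ : 1 ≤ ℓ)
    (hG : ¬ IsMinor (dominatedStars ℓ k) G) (r : V) :
    ∃ W : Set V, r ∈ W ∧ (∀ x ∈ W, {y | y ∈ W ∧ G.Adj x y}.ncard ≤ 2 * ℓ) ∧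
      (∀ x ∉ W, (outerLinks G W x).ncard ≤ hubBound ℓ k) ∧
      (G.induce (closedNbhd G W)).Connected := by
  classical
  have := Fintype.ofFinite V
  obtain ⟨w, p, hw0, hw, hmax⟩ := exists_maximal_hubSequence G (hubBound ℓ k) r
  set W : Set V := {x | ∃ a ≤ p, w a = x} with hW
  have hwW : ∀ a ≤ p, w a ∈ closedNbhd G W := fun a ha => Or.inl ⟨a, ha, rfl⟩
  refine ⟨W, ⟨0, Nat.zero_le _, hw0⟩, ?_, fun x hx => ?_, ?_⟩
  · rintro _ ⟨a, ha, rfl⟩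
    have h₁ := card_neighbours_in_hubs_le hℓ hG p hw a ha
    refine le_trans ?_ h₁
    rw [← Set.ncard_coe_finset]
    refine le_trans (Set.ncard_le_ncard ?_ (Set.toFinite _)) (Set.ncard_image_le (f := w)
      (Set.toFinite _))
    rintro _ ⟨⟨b, hb, rfl⟩, hab⟩
    refine ⟨b, Finset.mem_coe.2 (Finset.mem_filter.2 ⟨Finset.mem_range.2 ?_, hab⟩), rfl⟩
    omega
  · refine le_trans (Set.ncard_le_ncard ?_ (Set.toFinite _))
      (hmax x fun a ha h => hx ⟨a, ha, h⟩).le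
    rintro b ⟨hb, hxb, _, ⟨j, hj, rfl⟩, hbj⟩
    exact ⟨fun a ha h => hb ⟨a, ha, h⟩, hxb.symm, j, hj, hbj⟩
  · have key : ∀ i ≤ p, Joined G (closedNbhd G W) r (w i) := by
      intro i
      induction i using Nat.strong_induction_on with
      | _ i ih =>
        intro hi
        rcases Nat.eq_zero_or_pos i with rfl | h0
        · rw [hw0]
          exact Relation.ReflTransGen.refl
        · have hpos : 0 < {b | (∀ a < i, w a ≠ b) ∧ G.Adj b (w i) ∧ ∃ j < i, G.Adj b (w j)}.ncard :=
            lt_of_lt_of_le (Nat.succ_pos _) (hw.2 i hi h0)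
          obtain ⟨b, -, hbi, j, hj, hbj⟩ := (Set.ncard_pos (Set.toFinite _)).1 hpos
          exact ((ih j hj (hj.le.trans hi)).step hbj.symm
            (Or.inr ⟨_, ⟨i, hi, rfl⟩, hbi⟩)).step hbi (hwW i hi)
    refine connected_of_joined (v := r) (Or.inl ⟨0, Nat.zero_le _, hw0⟩) ?_
    rintro x (⟨a, ha, rfl⟩ | ⟨_, ⟨a, ha, rfl⟩, hxa⟩)
    · exact key a ha
    · exact (key a ha).step hxa.symm (Or.inr ⟨_, ⟨a, ha, rfl⟩, hxa⟩)

/-- The set of vertices of `G` that a vertex of the graph obtained by contracting `U` stands for. -/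
def contractFibre (U : Set V) : Option {z // z ∉ U} → Set V
  | none => U
  | some z => {z.1}

/-- The graph obtained from `G` by contracting `U` to the vertex `none`. -/
def contractSet (G : SimpleGraph V) (U : Set V) : SimpleGraph (Option {z // z ∉ U}) where
  Adj a b := a ≠ b ∧ ∃ x ∈ contractFibre U a, ∃ y ∈ contractFibre U b, G.Adj x y
  symm := ⟨fun _ _ h => ⟨h.1.symm, by
    obtain ⟨-, x, hx, y, hy, hxy⟩ := h
    exact ⟨y, hy, x, hx, hxy.symm⟩⟩⟩
  loopless := ⟨fun _ h => h.1 rfl⟩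

lemma isMinor_contractSet {G : SimpleGraph V} {U : Set V} (hU : (G.induce U).Connected) :
    IsMinor (contractSet G U) G := by
  refine ⟨contractFibre U, ?_, ?_, fun a b hab => hab.2⟩
  · rintro (_ | z)
    · exact hU
    · exact connected_induce_singleton G _
  · rintro (_ | a) (_ | b) hab
    · exact absurd rfl hab
    · simpa [contractFibre] using b.2
    · simpa [contractFibre] using a.2
    · have : a.1 ≠ b.1 := fun h => hab (by rw [Subtype.ext h])
      simpa [contractFibre] using this

/-- The neighbours of `v` of its own colour. -/
def sameColour (G : SimpleGraph V) (c : V → Bool) (v : V) : Set V := {y | G.Adj v y ∧ c y = c v}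

/-- The condition at the root is what makes the induction work: an outside vertex that gains defect
from the contracted set is a neighbour of the contracted root in the root's colour, so its defect
elsewhere is at most `2 * ℓ`. -/
theorem exists_rooted_colouring {ℓ k : ℕ} (hℓ : 1 ≤ ℓ) (n : ℕ) :
    ∀ {V : Type u} [Finite V] (G : SimpleGraph V), Nat.card V = n →
      ¬ IsMinor (dominatedStars ℓ k) G → ∀ (r : V) (γ : Bool), ∃ c : V → Bool, c r = γ ∧
        (∀ v, v = r ∨ (G.Adj v r ∧ c v = γ) → (sameColour G c v).ncard ≤ 2 * ℓ) ∧
        ∀ v, (sameColour G c v).ncard ≤ hubBound ℓ k + 2 * ℓ := by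
  classical
  induction n using Nat.strong_induction_on with
  | _ n ih =>
    intro V _ G hn hG r γ
    obtain ⟨W, hrW, hWW, hWL, hconn⟩ := exists_hubs hℓ hG r
    by_cases hr : ∃ x, G.Adj r x
    · obtain ⟨x, hx⟩ := hr
      set U := closedNbhd G W with hU
      have hrU : r ∈ U := Or.inl hrW
      have hxU : x ∈ U := Or.inr ⟨r, hrW, hx.symm⟩
      have hcard : Nat.card (Option {z // z ∉ U}) < n := by
        have h₁ : Nat.card (Option {z // z ∉ U}) = Uᶜ.ncard + 1 := Finite.card_option
        have h₂ : U.ncard + Uᶜ.ncard = n := by rw [Set.ncard_add_ncard_compl, hn]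
        have h₃ : 1 < U.ncard :=
          (Set.one_lt_ncard (Set.toFinite _)).2 ⟨r, hrU, x, hxU, hx.ne⟩
        omega
      -- The root of the quotient gets the colour of `U \ W`, the only vertices of `U` with
      -- neighbours outside `U`.
      obtain ⟨c', hc'r, hc'A, hc'B⟩ := ih _ hcard (contractSet G U) rfl
        (fun h => hG (h.trans (isMinor_contractSet hconn))) none (!γ)
      set c : V → Bool := fun v =>
        if v ∈ W then γ else if hv : v ∈ U then !γ else c' (some ⟨v, hv⟩) with hc
      have hcW : ∀ v ∈ W, c v = γ := fun v hv => by simp [hc, hv]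
      have hcL : ∀ v ∈ U, v ∉ W → c v = !γ := fun v hv hvW => by simp [hc, hv, hvW]
      have hcO : ∀ v (hv : v ∉ U), c v = c' (some ⟨v, hv⟩) := fun v hv => by
        have : v ∉ W := fun h => hv (Or.inl h)
        simp [hc, hv, this]
      have hWU : ∀ {v y}, v ∈ W → G.Adj v y → y ∈ U := fun {v y} hv h => Or.inr ⟨v, hv, h.symm⟩
      have boundW : ∀ v ∈ W, (sameColour G c v).ncard ≤ 2 * ℓ := by
        refine fun v hv => le_trans (Set.ncard_le_ncard ?_ (Set.toFinite _)) (hWW v hv)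
        rintro y ⟨hvy, hcy⟩
        refine ⟨?_, hvy⟩
        by_contra hyW
        rw [hcW v hv, hcL y (hWU hv hvy) hyW] at hcy
        simp at hcy
      have hU' : ∀ {v}, v ∈ U → v ∉ W → ∃ u ∈ W, G.Adj v u := fun {v} h h' => h.resolve_left h'
      let f : Option {z // z ∉ U} → V := fun z => z.elim r fun z => z.1
      have bound : ∀ v (z : Option {z // z ∉ U}), v ∉ W →
          (sameColour (contractSet G U) c' z).ncard ≤ 2 * ℓ →
          sameColour G c v ⊆ outerLinks G W v ∪ f '' sameColour (contractSet G U) c' z →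
          (sameColour G c v).ncard ≤ hubBound ℓ k + 2 * ℓ := by
        intro v z hv hz hsub
        have h₁ := Set.ncard_le_ncard hsub (Set.toFinite _)
        have h₂ := Set.ncard_union_le (outerLinks G W v)
          (f '' sameColour (contractSet G U) c' z)
        have h₃ := hWL v hv
        have h₄ := Set.ncard_image_le (f := f) (s := sameColour (contractSet G U) c' z)
          (Set.toFinite _)
        omega
      refine ⟨c, hcW r hrW, ?_, fun v => ?_⟩
      · rintro v (rfl | ⟨hvr, hcv⟩)
        · exact boundW _ hrW
        · refine boundW v ?_
          by_contra hvW
          rw [hcL v (Or.inr ⟨r, hrW, hvr⟩) hvW] at hcv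
          simp at hcv
      · by_cases hvW : v ∈ W
        · exact (boundW v hvW).trans (Nat.le_add_left _ _)
        by_cases hvU : v ∈ U
        · refine bound v none hvW (hc'A none (Or.inl rfl)) ?_
          rintro y ⟨hvy, hcy⟩
          rw [hcL v hvU hvW] at hcy
          by_cases hyU : y ∈ U
          · have hyW : y ∉ W := fun h => by
              rw [hcW y h] at hcy
              simp at hcy
            exact Or.inl ⟨hyW, hvy, hU' hyU hyW⟩
          · refine Or.inr ⟨some ⟨y, hyU⟩, ⟨⟨by simp, v, hvU, y, rfl, hvy⟩, ?_⟩, rfl⟩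
            rw [← hcO y hyU, hcy, hc'r]
        · have hadj : ∀ y (hy : y ∉ U), G.Adj v y →
              (contractSet G U).Adj (some ⟨v, hvU⟩) (some ⟨y, hy⟩) :=
            fun y hy hvy => ⟨by simpa using hvy.ne, v, rfl, y, rfl, hvy⟩
          -- If some neighbour in `U` shares the colour of `v`, the root condition in the quotient
          -- applies to `v`. If none does, all same-coloured neighbours survive in the quotient and
          -- the general bound carries over.
          by_cases hex : ∃ y ∈ U, G.Adj v y ∧ c y = c v
          · obtain ⟨y, hyU, hvy, hcy⟩ := hex
            have hyW : y ∉ W := fun h => hvU (hWU h hvy.symm)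
            rw [hcL y hyU hyW, hcO v hvU] at hcy
            refine bound v (some ⟨v, hvU⟩) hvW
              (hc'A _ (Or.inr ⟨⟨by simp, v, rfl, y, hyU, hvy⟩, hcy.symm⟩)) ?_
            rintro z ⟨hvz, hcz⟩
            by_cases hzU : z ∈ U
            · have hzW : z ∉ W := fun h => hvU (hWU h hvz.symm)
              exact Or.inl ⟨hzW, hvz, hU' hzU hzW⟩
            · exact Or.inr ⟨some ⟨z, hzU⟩, ⟨hadj z hzU hvz, by rw [← hcO z hzU, hcz, hcO v hvU]⟩, rfl⟩
          · refine le_trans (le_trans (Set.ncard_le_ncard ?_ (Set.toFinite _))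
              (Set.ncard_image_le (f := f) (Set.toFinite _))) (hc'B (some ⟨v, hvU⟩))
            rintro z ⟨hvz, hcz⟩
            have hzU : z ∉ U := fun h => hex ⟨z, h, hvz, hcz⟩
            exact ⟨some ⟨z, hzU⟩, ⟨hadj z hzU hvz, by rw [← hcO z hzU, hcz, hcO v hvU]⟩, rfl⟩
    -- For an isolated root the contraction need not shrink the graph, so `r` is deleted instead.
    · push Not at hr
      by_cases hsub : ∃ r', r' ≠ r
      · obtain ⟨r', hr'⟩ := hsub
        have hcard : Nat.card ({r}ᶜ : Set V) < n := by
          have h₁ := Set.ncard_add_ncard_compl ({r} : Set V)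
          rw [Set.ncard_singleton, hn] at h₁
          rw [Nat.card_coe_set_eq]
          omega
        obtain ⟨c', -, -, hc'⟩ := ih _ hcard (G.induce {r}ᶜ) rfl
          (fun h => hG (h.trans (isMinor_induce G _))) ⟨r', hr'⟩ γ
        set c : V → Bool := fun v => if hv : v = r then γ else c' ⟨v, hv⟩ with hc
        have hcO : ∀ v (hv : v ≠ r), c v = c' ⟨v, hv⟩ := fun v hv => by simp [hc, hv]
        have hr0 : sameColour G c r = ∅ := Set.eq_empty_of_forall_notMem fun y hy => hr y hy.1
        refine ⟨c, by simp [hc], ?_, fun v => ?_⟩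
        · rintro v (rfl | ⟨hvr, -⟩)
          · rw [hr0, Set.ncard_empty]
            exact Nat.zero_le _
          · exact absurd hvr.symm (hr v)
        · by_cases hv : v = r
          · rw [hv, hr0, Set.ncard_empty]
            exact Nat.zero_le _
          · refine le_trans (le_trans (Set.ncard_le_ncard ?_ (Set.toFinite _))
              (Set.ncard_image_le (f := Subtype.val) (Set.toFinite _))) (hc' ⟨v, hv⟩)
            rintro y ⟨hvy, hcy⟩
            have hy : y ≠ r := by
              rintro rfl
              exact hr v hvy.symm
            exact ⟨⟨y, hy⟩, ⟨hvy, by rw [← hcO y hy, hcy, hcO v hv]⟩, rfl⟩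
      · push Not at hsub
        have hempty : ∀ v, sameColour G (fun _ => γ) v = ∅ := fun v =>
          Set.eq_empty_of_forall_notMem fun y hy => hy.1.ne ((hsub v).trans (hsub y).symm)
        exact ⟨fun _ => γ, rfl, fun v _ => by simp [hempty], fun v => by simp [hempty]⟩

/-- The argument gives a bound of order `ℓ ^ 2 * k ^ 2`; the constant is the coefficient sum `2 + 4
+ 2 + 8 + 1 = 17`. -/
lemma hubBound_add_le {ℓ k : ℕ} (hℓ : 1 ≤ ℓ) (hk : 1 ≤ k) :
    hubBound ℓ k + 2 * ℓ ≤ 17 * ℓ ^ 10 * k ^ 3 := by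
  have h₁ : ℓ ^ 2 ≤ ℓ ^ 10 := Nat.pow_le_pow_right hℓ (by norm_num)
  have h₂ : k ^ 2 ≤ k ^ 3 := Nat.pow_le_pow_right hk (by norm_num)
  have h₃ : ℓ ^ 2 * k ^ 2 ≤ ℓ ^ 10 * k ^ 3 := Nat.mul_le_mul h₁ h₂
  have hk' : k ≤ k ^ 2 := by nlinarith
  have hl' : ℓ ≤ ℓ ^ 2 := by nlinarith
  have h₄ : ℓ * k ≤ ℓ ^ 2 * k ^ 2 := Nat.mul_le_mul hl' hk'
  have h₅ : ℓ ^ 2 * k ≤ ℓ ^ 2 * k ^ 2 := Nat.mul_le_mul le_rfl hk'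
  have h₆ : ℓ ≤ ℓ * k := Nat.le_mul_of_pos_right _ hk
  have h₇ : 1 ≤ ℓ * k := Nat.mul_pos hℓ hk
  have h₈ : hubBound ℓ k + 2 * ℓ = 2 * (ℓ ^ 2 * k ^ 2) + 4 * (ℓ ^ 2 * k) + 2 * (ℓ * k) + 8 * ℓ + 1 := by
    unfold hubBound linkBound
    ring
  rw [h₈, Nat.mul_assoc 17]
  omega

theorem defectColourable_of_dominatedStars_minorFree {ℓ k : ℕ} (hℓ : 1 ≤ ℓ) (hk : 1 ≤ k)
    {V : Type u} {G : SimpleGraph V} (hG : MinorFree (dominatedStars ℓ k) V G) :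
    DefectColourable G 2 (17 * ℓ ^ 10 * k ^ 3) := by
  obtain ⟨hfin, hG⟩ := hG
  rcases isEmpty_or_nonempty V with hV | ⟨⟨r⟩⟩
  · exact ⟨fun _ => 0, fun x => (hV.false x).elim⟩
  · obtain ⟨c, -, -, hc⟩ := exists_rooted_colouring hℓ (Nat.card V) G rfl hG r true
    refine ⟨fun v => finTwoEquiv.symm (c v), fun x => ?_⟩
    have h := (hc x).trans (hubBound_add_le hℓ hk)
    have heq : {y | G.Adj x y ∧ finTwoEquiv.symm (c y) = finTwoEquiv.symm (c x)} =
        sameColour G c x := by simp [sameColour]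
    rw [heq, ← (Set.toFinite (sameColour G c x)).cast_ncard_eq]
    exact_mod_cast h

end Colouring

end DefectiveColouring

namespace DefectiveColouring

/-! ### Tree-depth: embedding `H` in dominated stars, and the lower bound -/

section TreeDepth

variable {W : Type*}

/-- A partition of the vertices of `C` other than the at most one vertex in `z` such that each part
(a fibre of `q`) induces a star with centre in `cen`, and no edges join different parts. -/
def IsStarPartition {ι : Type*} (C : SimpleGraph W) (z : W → Prop) (q : W → ι) (cen : W → Prop) :
    Prop :=
  (∀ x y, z x → z y → x = y) ∧
  (∀ x y, ¬ z x → ¬ z y → cen x → cen y → q x = q y → x = y) ∧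
  ∀ x y, ¬ z x → ¬ z y → C.Adj x y → q x = q y ∧ (cen x ∧ ¬ cen y ∨ ¬ cen x ∧ cen y)

lemma exists_isMinor_dominatedStars_of_starPartition [Finite W] {ι : Type*} {H : SimpleGraph W}
    {z : W → Prop} {q : W → ι} {cen : W → Prop} (h : IsStarPartition H z q cen) :
    ∃ ℓ k, 2 ≤ ℓ ∧ 1 ≤ k ∧ IsMinor H (dominatedStars ℓ k) := by
  classical
  obtain ⟨hz, hcen, hadj⟩ := h
  have e := Finite.equivFin W
  set n := Nat.card W
  refine ⟨n + 2, n + 1, by omega, by omega, ?_⟩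
  rcases isEmpty_or_nonempty W with hW | hW
  · exact isMinor_of_hom (fun x => (hW.false x).elim) (fun x => (hW.false x).elim)
      fun x => (hW.false x).elim
  -- Parts are numbered through a chosen representative of each fibre of `q`.
  set idx : W → Fin (n + 2) := fun x => Fin.castLE (by omega) (e (Function.invFun q (q x)))
  have hidx : ∀ x y, idx x = idx y ↔ q x = q y := by
    refine fun x y => ⟨fun h => ?_, fun h => by simp only [idx, h]⟩
    have h₁ : Function.invFun q (q x) = Function.invFun q (q y) :=
      e.injective (Fin.castLE_injective _ h)
    rw [← Function.invFun_eq (f := q) ⟨x, rfl⟩, h₁, Function.invFun_eq (f := q) ⟨y, rfl⟩]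
  set lf : W → Fin (n + 1) := fun x => Fin.castLE (by omega) (e x)
  have hlf : Function.Injective lf := (Fin.castLE_injective _).comp e.injective
  refine isMinor_of_hom (fun x => if z x then none else
    if cen x then some (idx x, Sum.inl 0) else some (idx x, Sum.inr (lf x))) ?_ ?_
  · intro x y hxy
    dsimp only at hxy
    split_ifs at hxy with h₁ h₂ h₃ h₄ h₅ h₆ h₇ h₈
    · exact hz x y h₁ h₂
    · simp only [Option.some.injEq, Prod.mk.injEq, and_true] at hxy
      exact hcen x y h₁ h₅ h₄ h₆ ((hidx _ _).1 hxy)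
    · simp at hxy
    · simp at hxy
    · simp only [Option.some.injEq, Prod.mk.injEq, Sum.inr.injEq] at hxy
      exact hlf hxy.2
  · intro x y hxy
    have hne := hxy.ne
    have h := hadj x y
    split_ifs with h₁ h₂ h₃ h₄ h₅ h₆ h₇ h₈
    · exact absurd (hz x y h₁ h₂) hne
    · simp [dominatedStars, addDominant]
    · simp [dominatedStars, addDominant]
    · simp [dominatedStars, addDominant]
    · simp_all
    · have := (hidx x y).2 (h h₁ h₅ hxy).1
      simp [dominatedStars, addDominant, disjointCopies, this]
    · simp [dominatedStars, addDominant]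
    · have := (hidx x y).2 (h h₁ h₇ hxy).1
      simp [dominatedStars, addDominant, disjointCopies, this]
    · simp_all

lemma length_le_of_treeHeight_le {V : Type*} {T : SimpleGraph V} {r : V} {h : ℕ}
    (hT : treeHeight T r ≤ (h + 1 : ℕ)) {y : V} (p : T.Path r y) : (p : T.Walk r y).length ≤ h := by
  have h₁ : ((p : T.Walk r y).support.length : ℕ∞) ≤ (h + 1 : ℕ) :=
    (le_iSup₂ (f := fun y (p : T.Path r y) => ((p : T.Walk r y).support.length : ℕ∞)) y p).trans hT
  rw [SimpleGraph.Walk.length_support] at h₁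
  have := Nat.cast_le.1 h₁
  omega

lemma exists_tree_of_connectedTreeDepth_le {C : SimpleGraph W} {h : ℕ}
    (hC : connectedTreeDepth C ≤ (h + 1 : ℕ)) :
    ∃ (n : ℕ) (T : SimpleGraph (Fin n)) (r : Fin n) (f : W → Fin n), T.IsTree ∧
      (∀ y (p : T.Path r y), (p : T.Walk r y).length ≤ h) ∧ Function.Injective f ∧
      ∀ x y, C.Adj x y → (treeClosure T r).Adj (f x) (f y) := by
  have hne : {h : ℕ∞ | ∃ (n : ℕ) (T : SimpleGraph (Fin n)) (r : Fin n),
      T.IsTree ∧ treeHeight T r = h ∧ C.IsContained (treeClosure T r)}.Nonempty := by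
    by_contra hemp
    rw [Set.not_nonempty_iff_eq_empty] at hemp
    rw [connectedTreeDepth, hemp, sInf_empty] at hC
    exact absurd hC (by simp)
  obtain ⟨n, T, r, hT, hh, ⟨f⟩⟩ := csInf_mem hne
  refine ⟨n, T, r, f, hT, fun y p => length_le_of_treeHeight_le (hh.trans_le hC) p, f.injective,
    fun x y hxy => f.toHom.map_adj hxy⟩

lemma starPartition_of_connectedTreeDepth_le_two {C : SimpleGraph W}
    (hC : connectedTreeDepth C ≤ 2) :
    ∃ cen : W → Prop, IsStarPartition C (fun _ => False) (fun _ => 0) cen := by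
  obtain ⟨n, T, r, f, hT, hlen, hf, hadj⟩ := exists_tree_of_connectedTreeDepth_le (h := 1) hC
  have hanc : ∀ x y, x ≠ y → IsAncestor T r x y → x = r := by
    rintro x y hxy ⟨⟨p, hp⟩, hx⟩
    have := hlen y ⟨p, hp⟩
    match p with
    | .nil => simpa using hx
    | .cons h .nil =>
      simp at hx
      tauto
    | .cons h (.cons h' p) => simp at this
  refine ⟨fun x => f x = r, by simp, fun x y _ _ hx hy _ => hf (hx.trans hy.symm), ?_⟩
  intro x y _ _ hxy
  have hne : f x ≠ f y := fun h => hxy.ne (hf h)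
  refine ⟨rfl, ?_⟩
  rcases (hadj x y hxy).2 with h | h
  · have := hanc _ _ hne h
    exact Or.inl ⟨this, fun h => hne (this.trans h.symm)⟩
  · have := hanc _ _ hne.symm h
    exact Or.inr ⟨fun h => hne (h.trans this.symm), this⟩

/-- Deleting the root of a tree of height 3 leaves stars. A part is indexed by the second vertex on
the path from the root, and that vertex is its centre. -/
lemma starPartition_of_connectedTreeDepth_le_three {C : SimpleGraph W}
    (hC : connectedTreeDepth C ≤ 3) :
    ∃ (z : W → Prop) (q : W → ℕ) (cen : W → Prop), IsStarPartition C z q cen := by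
  obtain ⟨n, T, r, f, hT, hlen, hf, hadj⟩ := exists_tree_of_connectedTreeDepth_le (h := 2) hC
  have hex : ∀ y, Nonempty (T.Path r y) := fun y => by
    obtain ⟨p, hp⟩ := hT.1.exists_isPath r y
    exact ⟨⟨p, hp⟩⟩
  let P : ∀ y, T.Path r y := fun y => (hex y).some
  have hP : ∀ y (p : T.Path r y), P y = p := fun y p => (hT.2.subsingleton_path _ _).elim _ _
  let q : Fin n → Fin n := fun y => (P y : T.Walk r y).snd
  have hanc : ∀ x y, x ≠ y → x ≠ r → IsAncestor T r x y → q x = x ∧ q y = x := by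
    rintro x y hxy hxr ⟨⟨p, hp⟩, hx⟩
    have hle := hlen y ⟨p, hp⟩
    have hPy := hP y ⟨p, hp⟩
    match p with
    | .nil =>
      simp at hx
      exact absurd hx hxr
    | .cons h .nil =>
      simp at hx
      tauto
    | .cons (v := a) h (.cons h' .nil) =>
      have : x = a := by
        simp at hx
        tauto
      subst this
      have hPx := hP x (SimpleGraph.Path.singleton h)
      simp only [q]
      rw [hPx, hPy]
      simp [SimpleGraph.Path.singleton]
    | .cons h (.cons h' (.cons h'' p)) =>
      simp at hle
  refine ⟨fun x => f x = r, fun x => (q (f x) : ℕ), fun x => q (f x) = f x,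
    fun x y hx hy => hf (hx.trans hy.symm), fun x y _ _ hx hy hxy => ?_, ?_⟩
  · exact hf (hx.symm.trans ((Fin.ext hxy).trans hy))
  · intro x y hx hy hxy
    have hne : f x ≠ f y := fun h => hxy.ne (hf h)
    rcases (hadj x y hxy).2 with h | h
    · obtain ⟨h₁, h₂⟩ := hanc _ _ hne hx h
      exact ⟨congrArg Fin.val (h₁.trans h₂.symm), Or.inl ⟨h₁, fun h => hne (h₂.symm.trans h)⟩⟩
    · obtain ⟨h₁, h₂⟩ := hanc _ _ hne.symm hy h
      exact ⟨congrArg Fin.val (h₂.trans h₁.symm), Or.inr ⟨fun h => hne (h.symm.trans h₂), h₁⟩⟩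

/-- The star partitions of the components are combined by pairing the part with the component.
Uniqueness of the deep component leaves at most one vertex in `z`, and this vertex is sent to the
dominant one. -/
lemma exists_isMinor_dominatedStars [Finite W] {H : SimpleGraph W} (hH : treeDepth H = 3)
    (huniq : ∀ c₁ c₂ : H.ConnectedComponent, connectedTreeDepth c₁.toSimpleGraph = 3 →
      connectedTreeDepth c₂.toSimpleGraph = 3 → c₁ = c₂) :
    ∃ ℓ k, 2 ≤ ℓ ∧ 1 ≤ k ∧ IsMinor H (dominatedStars ℓ k) := by
  have hex : ∀ c : H.ConnectedComponent, ∃ (z : c → Prop) (q : c → ℕ) (cen : c → Prop),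
      IsStarPartition c.toSimpleGraph z q cen ∧
        (connectedTreeDepth c.toSimpleGraph ≠ 3 → ∀ x, ¬ z x) := by
    intro c
    have hle : connectedTreeDepth c.toSimpleGraph ≤ 3 :=
      hH ▸ le_iSup (fun c : H.ConnectedComponent => connectedTreeDepth c.toSimpleGraph) c
    by_cases h3 : connectedTreeDepth c.toSimpleGraph = 3
    · obtain ⟨z, q, cen, h⟩ := starPartition_of_connectedTreeDepth_le_three hle
      exact ⟨z, q, cen, h, fun h => absurd h3 h⟩
    · have hle2 : connectedTreeDepth c.toSimpleGraph ≤ 2 :=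
        ENat.lt_add_one_iff (by simp) |>.1 (lt_of_le_of_ne hle h3)
      obtain ⟨cen, h⟩ := starPartition_of_connectedTreeDepth_le_two hle2
      exact ⟨_, _, cen, h, fun _ _ h => h⟩
  choose z q cen hpart hz using hex
  have hmk : ∀ x, x ∈ (H.connectedComponentMk x).supp := fun x => rfl
  -- The data are indexed by components, so two vertices of one component must first be viewed in
  -- the same subtype.
  have transfer : ∀ (x : W) (c : H.ConnectedComponent) (hx : x ∈ c.supp),
      (z _ ⟨x, hmk x⟩ = z c ⟨x, hx⟩) ∧ (q _ ⟨x, hmk x⟩ = q c ⟨x, hx⟩) ∧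
      (cen _ ⟨x, hmk x⟩ = cen c ⟨x, hx⟩) := by
    rintro x c rfl
    exact ⟨rfl, rfl, rfl⟩
  have same : ∀ x y, H.connectedComponentMk y = H.connectedComponentMk x →
      y ∈ (H.connectedComponentMk x).supp := fun x y h => h
  refine exists_isMinor_dominatedStars_of_starPartition (H := H)
    (z := fun x => z _ ⟨x, hmk x⟩) (q := fun x => (H.connectedComponentMk x, q _ ⟨x, hmk x⟩))
    (cen := fun x => cen _ ⟨x, hmk x⟩) ⟨fun x y hx hy => ?_, ?_, ?_⟩
  · have hc : H.connectedComponentMk y = H.connectedComponentMk x :=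
      huniq _ _ (by_contra fun h => hz _ h _ hy) (by_contra fun h => hz _ h _ hx)
    dsimp only at hx hy
    rw [(transfer y _ (same x y hc)).1] at hy
    exact congrArg Subtype.val ((hpart _).1 _ _ hx hy)
  · intro x y hx hy hcx hcy hxy
    obtain ⟨hc, hq⟩ := Prod.mk.injEq _ _ _ _ ▸ hxy
    obtain ⟨t₁, t₂, t₃⟩ := transfer y _ (same x y hc.symm)
    dsimp only at hx hy hcx hcy
    rw [t₁] at hy
    rw [t₂] at hq
    rw [t₃] at hcy
    exact congrArg Subtype.val ((hpart _).2.1 _ _ hx hy hcx hcy hq)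
  · intro x y hx hy hxy
    have hc : H.connectedComponentMk y = H.connectedComponentMk x :=
      SimpleGraph.ConnectedComponent.sound hxy.symm.reachable
    obtain ⟨t₁, t₂, t₃⟩ := transfer y _ (same x y hc)
    dsimp only at hx hy ⊢
    rw [t₁] at hy
    obtain ⟨h₁, h₂⟩ := (hpart _).2.2 ⟨x, hmk x⟩ ⟨y, same x y hc⟩ hx hy hxy
    rw [t₃]
    exact ⟨Prod.ext hc.symm (h₁.trans t₂.symm), h₂⟩

lemma connectedTreeDepth_le_two [Finite W] {C : SimpleGraph W} {s : W}
    (hs : ∀ x y, C.Adj x y → x = s ∨ y = s) : connectedTreeDepth C ≤ 2 := by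
  have e := Finite.equivFin W
  have hT := SimpleGraph.isTree_starGraph (e s)
  have hheight : treeHeight (SimpleGraph.starGraph (e s)) (e s) ≤ 2 := by
    refine iSup₂_le fun y p => ?_
    by_cases hy : e s = y
    · subst hy
      rw [(hT.2.subsingleton_path _ _).elim p SimpleGraph.Path.nil]
      simp [SimpleGraph.Path.nil]
    · rw [(hT.2.subsingleton_path _ _).elim p
        (SimpleGraph.Path.singleton (SimpleGraph.starGraph_center_adj hy))]
      simp [SimpleGraph.Path.singleton]
  have hanc : ∀ y, IsAncestor (SimpleGraph.starGraph (e s)) (e s) (e s) y := fun y => by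
    obtain ⟨p, hp⟩ := hT.1.exists_isPath (e s) y
    exact ⟨⟨p, hp⟩, SimpleGraph.Walk.start_mem_support _⟩
  have hadj : ∀ {x y}, C.Adj x y →
      (treeClosure (SimpleGraph.starGraph (e s)) (e s)).Adj (e x) (e y) := by
    intro x y hxy
    refine ⟨fun h => hxy.ne (e.injective h), ?_⟩
    rcases hs x y hxy with rfl | rfl
    · exact Or.inl (hanc _)
    · exact Or.inr (hanc _)
  refine le_trans (csInf_le' ?_) hheight
  exact ⟨_, _, _, hT, rfl, ⟨⟨⟨e, hadj⟩, e.injective⟩⟩⟩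

/-- Every edge of the star contains `o`, so every edge of `H` has an end whose branch set contains
`o`; by disjointness there is at most one such vertex. -/
lemma treeDepth_le_two_of_isMinor_starGraph [Finite W] {H : SimpleGraph W} {V : Type*} {o : V}
    (h : IsMinor H (SimpleGraph.starGraph o)) : treeDepth H ≤ 2 := by
  obtain ⟨B, -, hdisj, hadj⟩ := h
  refine iSup_le fun c => ?_
  obtain ⟨x₀, hx₀⟩ := c.nonempty_supp
  have hw : ∀ w, o ∈ B w → ∀ x y, H.Adj x y → x = w ∨ y = w := by
    intro w hw x y hxy
    obtain ⟨a, ha, b, hb, hab⟩ := hadj x y hxy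
    rw [SimpleGraph.starGraph_adj] at hab
    by_contra hne
    push Not at hne
    rcases hab.2 with rfl | rfl
    · exact Set.disjoint_left.1 (hdisj _ _ hne.1) ha hw
    · exact Set.disjoint_left.1 (hdisj _ _ hne.2) hb hw
  by_cases hex : ∃ w : c, o ∈ B w
  · obtain ⟨w, hwo⟩ := hex
    exact connectedTreeDepth_le_two (s := w) fun x y hxy =>
      (hw w hwo x y hxy).imp Subtype.ext Subtype.ext
  -- A component without such a vertex has no edges, so any of its vertices serves as centre.
  · push Not at hex
    refine connectedTreeDepth_le_two (s := ⟨x₀, hx₀⟩) fun x y hxy => ?_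
    obtain ⟨a, ha, b, hb, hab⟩ := hadj x.1 y.1 hxy
    rw [SimpleGraph.starGraph_adj] at hab
    rcases hab.2 with rfl | rfl
    · exact absurd ha (hex x)
    · exact absurd hb (hex y)

lemma two_le_of_forall_minorFree_defectColourable [Finite W] {H : SimpleGraph W}
    (hH : treeDepth H = 3) {k d : ℕ}
    (h : ∀ (V : Type u) (G : SimpleGraph V), MinorFree H V G → DefectColourable G k d) : 2 ≤ k := by
  -- On `d + 2` vertices the centre has `d + 1` neighbours, too many for a single colour with defect
  -- `d`.
  let o : ULift.{u} (Fin (d + 2)) := ⟨0⟩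
  obtain ⟨c, hc⟩ := h _ (SimpleGraph.starGraph o) ⟨inferInstance, fun hm => by
    have := treeDepth_le_two_of_isMinor_starGraph hm
    rw [hH] at this
    exact absurd this (by decide)⟩
  by_contra hk
  have hsub : Subsingleton (Fin k) := Fin.subsingleton_iff_le_one.2 (by omega)
  have heq : {y | (SimpleGraph.starGraph o).Adj o y ∧ c y = c o} = {o}ᶜ := by
    ext y
    simp [Subsingleton.elim (c y) (c o), eq_comm]
  have h₁ := hc o
  rw [heq, ← (Set.toFinite _).cast_ncard_eq] at h₁
  have h₂ := Nat.cast_le.1 h₁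
  have h₃ := Set.ncard_add_ncard_compl ({o} : Set (ULift.{u} (Fin (d + 2))))
  rw [Set.ncard_singleton] at h₃
  simp at h₃
  omega

end TreeDepth

end DefectiveColouring

theorem mainTheorem11 :
    (∀ (W : Type v) [Finite W] (H : SimpleGraph W),
      DefectiveColouring.treeDepth H = 3 →
      (∀ c₁ c₂ : H.ConnectedComponent,
        DefectiveColouring.connectedTreeDepth c₁.toSimpleGraph = 3 →
        DefectiveColouring.connectedTreeDepth c₂.toSimpleGraph = 3 → c₁ = c₂) →
      DefectiveColouring.IsDefectiveChromaticNumber.{u}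
        (fun V G => DefectiveColouring.MinorFree H V G) 2) ∧
    (∃ C : ℕ, ∀ ℓ k : ℕ, 2 ≤ ℓ → 1 ≤ k →
      ∀ (V : Type u) (G : SimpleGraph V),
        DefectiveColouring.MinorFree (DefectiveColouring.dominatedStars ℓ k) V G →
        DefectiveColouring.DefectColourable G 2 (C * ℓ ^ 10 * k ^ 3)) := by
  refine ⟨fun W _ H hH huniq => ⟨?_, ?_⟩, 17, fun ℓ k hℓ hk V G hG =>
    DefectiveColouring.defectColourable_of_dominatedStars_minorFree (by omega) hk hG⟩
  · obtain ⟨ℓ, k, hℓ, hk, hm⟩ := DefectiveColouring.exists_isMinor_dominatedStars hH huniq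
    exact ⟨_, fun V G hG => DefectiveColouring.defectColourable_of_dominatedStars_minorFree
      (by omega) hk ⟨hG.1, fun h => hG.2 (hm.trans h)⟩⟩
  · rintro k ⟨d, hd⟩
    exact DefectiveColouring.two_le_of_forall_minorFree_defectColourable hH hd
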